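/- **Setting.** Let $\mathrm{grp}\langle x_1,\dots,x_n \mid \rho_1,\dots,\rho_m\rangle$ be a finite presentation of a group $G$, where the relator labelled $\rho_j$ is given by a word $w_j$ in the letters $x_i^{\pm1}$. Let $F=F(X)$ be the free group on $X=\{x_1,\dots,x_n\}$, and let $\theta:F\to G$ be the quotient map. * *Crossed module.* $\delta_2:C(R)\to F$ is the free crossed $F$-module on the relators. It is generated by the elements $(\rho,u)$, with $\rho$ a relator label and $u\in F$, subject to the Peiffer relations, with $\delta_2(\rho,u)=u^{-1}w(\rho)u$ and $(\rho,u)^v=(\rho,uv)$. Its elements are represented by $Y$-sequences, i.e. finite products of symbols $(\rho,u)^{\pm1}$. The $\mathbb{Z}G$-module $\pi_2=\ker\delta_2$ is the module of identities among relations. * *Groupoids.* $F(\widetilde X)$ is the free groupoid on the Cayley graph $\widetilde X$. Its objects are the elements of $G$ and its arrows are $[g,u]:g\to g\,\theta(u)$ for $u\in F$. $C(\widetilde R)(g)$ is the group of pairs $[g,c]$ with $c\in C(R)$, and $\tilde\delta_2[g,c]=[g,\delta_2c]$, $p_2[g,c]=c$. * *Rewriting.* Rewriting takes place on words in the letters $x_i^{\pm1}$.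 An extra-information rewriting system (EIRS) is a finite list $R2$ of triples $(l,c,r)$, with $l,r$ words and $c$ a $Y$-sequence, such that $l=\delta_2(c)\,r$ in $F$. It is complete (for the presentation) if the rules $l\to r$ form a Noetherian and confluent system $R1$ whose congruence on words is equality in $G$. For $(l,c,r)\in R2$ a reduction step sends $ulv$ to $urv$ and records $c^{u^{-1}}$. $\mathtt{ReduceWord2}(z,R2)$ applies such steps to $z$ as long as possible and returns $(c',z')$, where $c'$ is the product of the records and $z'$ is irreducible. * *Completion.* For an admissible well-ordering $>$ of the words (total, well-founded, and $p>q$ implies $upv>uqv$), the presentation is completable with respect to $>$ if some finite complete rewriting system for it has $l>r$ for all its rules. $\mathtt{KB2}$ starts from the rules $(x_ix_i^{-1},\mathrm{id},\mathrm{id})$, $(x_i^{-1}x_i,\mathrm{id},\mathrm{id})$ and $(w_j,(\rho_j,\mathrm{id}),\mathrm{id})$ for $w_j$ nonempty. In each pass it forms all critical pairs of rules $(l_1,c_1,r_1),(l_2,c_2,r_2)$: $(u_1r_1v_1,r_2)$ if $u_1l_1v_1=l_2$, and $(u_1r_1,r_2v_2)$ if $u_1l_1=l_2v_2$ with $|u_1|<|l_2|$.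 It reduces the two sides to $(d_1,z_1)$ and $(d_2,z_2)$ with $\mathtt{ReduceWord2}$. It adds $(z_1,\,d_1^{-1}c_1^{-u_1^{-1}}c_2d_2,\,z_2)$ if $z_1>z_2$, and $(z_2,\,d_2^{-1}c_2^{-1}c_1^{u_1^{-1}}d_1,\,z_1)$ if $z_2>z_1$. It stops when a pass adds nothing. **Theorem.** 1. If the presentation is completable with respect to an admissible well-ordering $>$, then $\mathtt{KB2}$ terminates and returns a complete EIRS $R2$ for the presentation, with $l>r$ for each of its rules. 2. Let $R2$ be any complete EIRS for the presentation. Then $R1$ has a unique normal form function $N$, assigning to each $g\in G$ the irreducible word $N(g)$ to which every word representing $g$ reduces. It determines the arrows $h_0(g)=[\mathrm{id},N(g)]^{-1}:g\to \mathrm{id}$. There is a unique morphism $h_1:F(\widetilde X)\to C(\widetilde R)(\mathrm{id})$ whose value on each edge $[g,x]$ of the Cayley graph is $$h_1[g,x]=[\mathrm{id},\mathtt{ReduceWord2}(N(g)\,x\,N(g\,\theta x)^{-1},R2)[1]].$$ It satisfies $h_0(\mathrm{id})=\mathrm{id}$ and $$\tilde\delta_2h_1[g,u]=h_0(g)^{-1}\,[g,u]\,h_0(g\,\theta(u))\quad\text{for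 all arrows }[g,u].$$ The elements $\mathrm{sep}(g,\rho)=p_2(h_1\tilde\delta_2[g,\rho])^{-1}\rho^{N(g)^{-1}}$, for $g\in G$ and $\rho$ a relator, lie in $\pi_2$ and generate it as a $\mathbb{Z}G$-module. 3. For every computable family of orderings $(>_a)$ on words in $x_1^{\pm1},x_2^{\pm1},\dots$ there are algorithms (partial recursive functions) that work uniformly, as follows. The input is an index $a$ and a finite presentation on which $>_a$ is an admissible well-ordering and which is completable with respect to it. Let $R2$ be the output of $\mathtt{KB2}$, with $N$, $h_0$, $h_1$ and $\mathrm{sep}$ as in part 2. The algorithms compute: $R2$; the word $N(g)$, and hence $h_0(g)$, from any word representing $g$; a $Y$-sequence for $p_2h_1[g,x]$, namely $\mathtt{ReduceWord2}(N(g)xN(g\,\theta x)^{-1},R2)[1]$, from $x$ and any word representing $g$; and, if $G$ is finite, the list of all $N(g)$, $g\in G$, without repetition, together with a finite list of $Y$-sequences representing exactly the elements $\mathrm{sep}(g,\rho)$, which generate the $\mathbb{Z}G$-module $\pi_2$. -/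

import Mathlib

/-! Identities among relations: free crossed modules, Cayley groupoids, extra information
rewriting systems and their completion. Names live in the namespace `IdRel`. -/

namespace IdRel

open CategoryTheory

section CrossedModule

/-- The group presented by `grp⟨X | ℛ, w⟩`. -/
abbrev Grp {X ℛ : Type*} (w : ℛ → FreeGroup X) : Type _ := PresentedGroup (Set.range w)

/-- The quotient morphism `θ : F(X) → G`. -/
abbrev theta {X ℛ : Type*} (w : ℛ → FreeGroup X) : FreeGroup X →* Grp w :=
  PresentedGroup.mk (Set.range w)

/-- The Peiffer elements `y⁻¹ z y (z ^ δ y)⁻¹`, for `y = (ρ, u)` and `z = (σ, v)` in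
`Y = ℛ × F(X)`, where `δ y = u⁻¹ (w ρ) u` and `(σ, v) ^ x = (σ, v x)`. -/
def peiffer {X ℛ : Type*} (w : ℛ → FreeGroup X) : Set (FreeGroup (ℛ × FreeGroup X)) :=
  {t | ∃ (ρ : ℛ) (u : FreeGroup X) (σ : ℛ) (v : FreeGroup X),
    t = (FreeGroup.of (ρ, u))⁻¹ * FreeGroup.of (σ, v) * FreeGroup.of (ρ, u) *
      (FreeGroup.of (σ, v * (u⁻¹ * w ρ * u)))⁻¹}

/-- The free crossed `F(X)`-module `C(R)` on `w : ℛ → F(X)`: the free group on `ℛ × F(X)`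
modulo Peiffer equivalence. -/
abbrev C {X ℛ : Type*} (w : ℛ → FreeGroup X) : Type _ := PresentedGroup (peiffer w)

/-- The generator `(ρ, u)` of `C(R)`. -/
def gen {X ℛ : Type*} (w : ℛ → FreeGroup X) (ρ : ℛ) (u : FreeGroup X) : C w :=
  PresentedGroup.of (ρ, u)

lemma gen_peiffer {X ℛ : Type*} (w : ℛ → FreeGroup X) (ρ : ℛ) (u : FreeGroup X) (σ : ℛ)
    (v : FreeGroup X) :
    (gen w ρ u)⁻¹ * gen w σ v * gen w ρ u = gen w σ (v * (u⁻¹ * w ρ * u)) := by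
  rw [← mul_inv_eq_one]
  exact PresentedGroup.one_of_mem (rels := peiffer w) ⟨ρ, u, σ, v, rfl⟩

/-- The boundary `δ₂ : C(R) → F(X)`, `(ρ, u) ↦ u⁻¹ (w ρ) u`. -/
def delta {X ℛ : Type*} (w : ℛ → FreeGroup X) : C w →* FreeGroup X :=
  PresentedGroup.toGroup (f := fun y : ℛ × FreeGroup X => y.2⁻¹ * w y.1 * y.2) (by
    rintro t ⟨ρ, u, σ, v, rfl⟩
    simp only [map_mul, map_inv, FreeGroup.lift_apply_of]
    group)

@[simp] lemma delta_gen {X ℛ : Type*} (w : ℛ → FreeGroup X) (ρ : ℛ) (u : FreeGroup X) :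
    delta w (gen w ρ u) = u⁻¹ * w ρ * u := by
  simp [delta, gen]

/-- The right action `c ↦ c ^ x` of `x : F(X)` on `C(R)`, `(ρ, u) ^ x = (ρ, u x)`. -/
def act {X ℛ : Type*} (w : ℛ → FreeGroup X) (x : FreeGroup X) : C w →* C w :=
  PresentedGroup.toGroup (f := fun y : ℛ × FreeGroup X => gen w y.1 (y.2 * x)) (by
    rintro t ⟨ρ, u, σ, v, rfl⟩
    simp only [map_mul, map_inv, FreeGroup.lift_apply_of]
    rw [gen_peiffer, mul_inv_eq_one]
    congr 1
    group)

@[simp] lemma act_gen {X ℛ : Type*} (w : ℛ → FreeGroup X) (x : FreeGroup X) (ρ : ℛ)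
    (u : FreeGroup X) : act w x (gen w ρ u) = gen w ρ (u * x) := by
  simp [act, gen]

lemma hom_ext {X ℛ : Type*} {w : ℛ → FreeGroup X} {H : Type*} [Group H] {f g : C w →* H}
    (h : ∀ ρ u, f (gen w ρ u) = g (gen w ρ u)) : f = g :=
  PresentedGroup.ext fun y => h y.1 y.2

lemma act_one {X ℛ : Type*} (w : ℛ → FreeGroup X) (c : C w) : act w 1 c = c := by
  have : act w 1 = MonoidHom.id _ := hom_ext fun ρ u => by simp
  simp [this]

lemma act_act {X ℛ : Type*} (w : ℛ → FreeGroup X) (x y : FreeGroup X) (c : C w) :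
    act w y (act w x c) = act w (x * y) c := by
  have : (act w y).comp (act w x) = act w (x * y) :=
    hom_ext fun ρ u => by simp [mul_assoc]
  exact DFunLike.congr_fun this c

/-- The first crossed module axiom. -/
lemma delta_act {X ℛ : Type*} (w : ℛ → FreeGroup X) (x : FreeGroup X) (c : C w) :
    delta w (act w x c) = x⁻¹ * delta w c * x := by
  have : (delta w).comp (act w x) = (MulAut.conj x⁻¹).toMonoidHom.comp (delta w) :=
    hom_ext fun ρ u => by simp [mul_assoc]
  simpa using DFunLike.congr_fun this c

/-- The second crossed module axiom. -/
lemma peiffer_rule {X ℛ : Type*} (w : ℛ → FreeGroup X) (c d : C w) :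
    c⁻¹ * d * c = act w (delta w c) d := by
  let T : Subgroup (C w) :=
    { carrier := {c | ∀ d, c⁻¹ * d * c = act w (delta w c) d}
      one_mem' := fun d => by simp [act_one]
      mul_mem' := by
        intro a b ha hb d
        rw [map_mul, ← act_act, ← hb, ← ha]
        group
      inv_mem' := by
        intro a ha d
        have h := ha (act w (delta w a⁻¹) d)
        rw [act_act] at h
        simp only [map_inv, inv_mul_cancel, act_one] at h
        rw [map_inv, inv_inv]
        nth_rewrite 1 [← h]
        group }
  have hT : ∀ c : C w, c ∈ T := by
    intro c
    have hle : Subgroup.closure (Set.range (PresentedGroup.of : ℛ × FreeGroup X → C w)) ≤ T := by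
      rw [Subgroup.closure_le]
      rintro _ ⟨⟨ρ, u⟩, rfl⟩ d
      have h : (MulAut.conj (gen w ρ u)⁻¹).toMonoidHom = act w (delta w (gen w ρ u)) :=
        hom_ext fun σ v => by simpa using gen_peiffer w ρ u σ v
      simpa [gen] using DFunLike.congr_fun h d
    rw [PresentedGroup.closure_range_of] at hle
    exact hle trivial
  exact hT c d

lemma theta_delta {X ℛ : Type*} (w : ℛ → FreeGroup X) (c : C w) :
    theta w (delta w c) = 1 := by
  have : (theta w).comp (delta w) = 1 := hom_ext fun ρ u => by
    have h : theta w (w ρ) = 1 := PresentedGroup.one_of_mem (Set.mem_range_self ρ)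
    simp [h]
  exact DFunLike.congr_fun this c

end CrossedModule

section Identities

/-- The identities among relations: the kernel of `δ₂`. -/
abbrev Ident {X ℛ : Type*} (w : ℛ → FreeGroup X) : Type _ := (delta w).ker

instance {X ℛ : Type*} (w : ℛ → FreeGroup X) : CommGroup (Ident w) :=
  { (inferInstance : Group (delta w).ker) with
    mul_comm := by
      rintro ⟨a, ha⟩ ⟨b, hb⟩
      apply Subtype.ext
      have h := peiffer_rule w b a
      rw [MonoidHom.mem_ker.1 hb, act_one, mul_assoc, inv_mul_eq_iff_eq_mul] at h
      exact h }

/-- `π₂`, the group of identities among relations, written additively. -/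
abbrev Pi2 {X ℛ : Type*} (w : ℛ → FreeGroup X) : Type _ := Additive (Ident w)

/-- The element of `C(R)` underlying an element of `π₂`. -/
def Pi2.val {X ℛ : Type*} {w : ℛ → FreeGroup X} (a : Pi2 w) : C w := (a.toMul : C w)

/-- The endomorphism `c ↦ c ^ x` of `π₂`. -/
def actKer {X ℛ : Type*} (w : ℛ → FreeGroup X) (x : FreeGroup X) : Ident w →* Ident w where
  toFun c := ⟨act w x c, by
    rw [MonoidHom.mem_ker, delta_act, MonoidHom.mem_ker.1 c.2]; simp⟩
  map_one' := by ext; simp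
  map_mul' a b := by ext; simp

/-- `F(X)` acts on the left of `π₂` by `x • c = c ^ (x⁻¹)`. -/
def freeRep {X ℛ : Type*} (w : ℛ → FreeGroup X) : FreeGroup X →* Module.End ℤ (Pi2 w) where
  toFun x := (MonoidHom.toAdditive (actKer w x⁻¹)).toIntLinearMap
  map_one' := by
    ext a
    simp [actKer, act_one]
  map_mul' x y := by
    ext a
    simp [actKer, act_act]

/-- The induced action of `G` on `π₂`: `θ(x) • c = c ^ (x⁻¹)`. -/
def rep {X ℛ : Type*} (w : ℛ → FreeGroup X) : Grp w →* Module.End ℤ (Pi2 w) :=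
  QuotientGroup.lift (Subgroup.normalClosure (Set.range w)) (freeRep w) (by
    intro x hx
    have hle : Subgroup.normalClosure (Set.range w) ≤ (freeRep w).ker := by
      apply Subgroup.normalClosure_le_normal
      rintro _ ⟨ρ, rfl⟩
      change freeRep w (w ρ) = 1
      ext a
      change act w (w ρ)⁻¹ (a.toMul : C w) = (a.toMul : C w)
      have hd : delta w (gen w ρ 1)⁻¹ = (w ρ)⁻¹ := by simp
      rw [← hd, ← peiffer_rule]
      have h2 := peiffer_rule w (a.toMul : C w) (gen w ρ 1)
      rw [MonoidHom.mem_ker.1 a.toMul.2, act_one, mul_assoc, inv_mul_eq_iff_eq_mul] at h2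
      rw [inv_inv, h2, mul_inv_cancel_right]
    exact hle hx)

/-- `π₂` as a `ℤG`-module. The right action `c ^ g` is turned into a left action by inversion,
which does not change the submodules. -/
noncomputable instance {X ℛ : Type*} (w : ℛ → FreeGroup X) :
    Module (MonoidAlgebra ℤ (Grp w)) (Pi2 w) :=
  Module.compHom (Pi2 w) (MonoidAlgebra.lift ℤ (Module.End ℤ (Pi2 w)) (Grp w) (rep w)).toRingHom

end Identities

section Cayley

/-- The objects of the free groupoid `F(X̃)` on the Cayley graph: the elements of `G`. -/
def Cayley {X ℛ : Type*} (w : ℛ → FreeGroup X) : Type _ := Grp w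

/-- The groupoid `F(X̃)`: an arrow `[g, u] : g ⟶ g (θ u)` is given by `u : F(X)`, and
`[g, u] ≫ [g (θ u), v] = [g, u v]`. -/
instance {X ℛ : Type*} (w : ℛ → FreeGroup X) : Groupoid (Cayley w) where
  Hom g h := {u : FreeGroup X // (show Grp w from g) * theta w u = (show Grp w from h)}
  id g := ⟨1, by rw [map_one]; exact mul_one (M := Grp w) g⟩
  comp f k := ⟨f.1 * k.1, by rw [map_mul, ← mul_assoc, f.2, k.2]⟩
  inv f := ⟨f.1⁻¹, by rw [map_inv, mul_inv_eq_iff_eq_mul]; exact f.2.symm⟩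
  id_comp f := Subtype.ext (one_mul _)
  comp_id f := Subtype.ext (mul_one _)
  assoc f k l := Subtype.ext (mul_assoc _ _ _)
  inv_comp f := Subtype.ext (inv_mul_cancel _)
  comp_inv f := Subtype.ext (mul_inv_cancel _)

/-- An element `g` of `G` as an object of `F(X̃)`. -/
def ob {X ℛ : Type*} (w : ℛ → FreeGroup X) (g : Grp w) : Cayley w := g

/-- The arrow `[g, u] : g ⟶ h`, where `h = g (θ u)`. -/
def arr {X ℛ : Type*} (w : ℛ → FreeGroup X) {g h : Grp w} (u : FreeGroup X)
    (e : g * theta w u = h) : ob w g ⟶ ob w h := ⟨u, e⟩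

/-- The edge `[g, x] : g ⟶ g (θ x)` of the Cayley graph. -/
def edge {X ℛ : Type*} (w : ℛ → FreeGroup X) (g : Grp w) (x : X) :
    ob w g ⟶ ob w (g * theta w (FreeGroup.of x)) := arr w (FreeGroup.of x) rfl

/-- The vertex group `C(R̃)(g)`, whose elements are the pairs `[g, c]` with `c : C(R)`. -/
@[ext] structure CTilde {X ℛ : Type*} (w : ℛ → FreeGroup X) (g : Grp w) where
  /-- the projection `p₂ [g, c] = c` -/
  p2 : C w

/-- `C(R̃)(g)` is identified with `C(R)` by `p₂`. -/
def CTilde.equiv {X ℛ : Type*} (w : ℛ → FreeGroup X) (g : Grp w) : CTilde w g ≃ C w where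
  toFun c := c.p2
  invFun c := ⟨c⟩

instance {X ℛ : Type*} (w : ℛ → FreeGroup X) (g : Grp w) : Group (CTilde w g) :=
  (CTilde.equiv w g).group

/-- `δ̃₂ [g, c] = [g, δ₂ c]`. -/
def deltaTilde {X ℛ : Type*} (w : ℛ → FreeGroup X) {g : Grp w} (c : CTilde w g) :
    ob w g ⟶ ob w g := arr w (delta w c.p2) (by rw [theta_delta, mul_one])

/-- A morphism from the groupoid `F(X̃)` to the group `C(R̃)(id)`. -/
@[ext] structure GroupoidHom {X ℛ : Type*} (w : ℛ → FreeGroup X) where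
  /-- the function on arrows -/
  map : ∀ {g h : Cayley w}, (g ⟶ h) → CTilde w 1
  map_comp : ∀ {g h k : Cayley w} (f : g ⟶ h) (f' : h ⟶ k), map (f ≫ f') = map f * map f'

/-- `(h₀, h₁)` is a partial contracting homotopy: `h₀ g` is an arrow from `g` to `id`, with
`h₀ id = id`; `h₁` is a morphism; and `δ̃₂ (h₁ [g, u]) = (h₀ g)⁻¹ [g, u] h₀ (g (θ u))` for every
arrow `[g, u]`. -/
def IsContractingHomotopy {X ℛ : Type*} (w : ℛ → FreeGroup X)
    (h0 : ∀ g : Cayley w, g ⟶ ob w 1) (h1 : GroupoidHom w) : Prop :=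
  h0 (ob w 1) = 𝟙 (ob w 1) ∧
  ∀ {g h : Cayley w} (f : g ⟶ h),
    deltaTilde w (h1.map f) = Groupoid.inv (h0 g) ≫ f ≫ h0 h

end Cayley

section Rewriting

/-- Words in the generators and their inverses: `(x, true)` stands for `x`, and `(x, false)`
for `x⁻¹`. -/
abbrev Word (X : Type*) : Type _ := List (X × Bool)

/-- One step `u l v → u r v` of the reduction relation generated by a set of rules. -/
def Step {X : Type*} (S : Set (Word X × Word X)) (a b : Word X) : Prop :=
  ∃ l r u v, (l, r) ∈ S ∧ a = u ++ l ++ v ∧ b = u ++ r ++ v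

/-- The word `a` is irreducible. -/
def Irred {X : Type*} (S : Set (Word X × Word X)) (a : Word X) : Prop := ∀ b, ¬ Step S a b

/-- `S` is complete: its reduction relation is Noetherian and confluent. -/
def IsComplete {X : Type*} (S : Set (Word X × Word X)) : Prop :=
  (¬ ∃ t : ℕ → Word X, ∀ i, Step S (t i) (t (i + 1))) ∧
  ∀ t a b, Relation.ReflTransGen (Step S) t a → Relation.ReflTransGen (Step S) t b →
    ∃ v, Relation.ReflTransGen (Step S) a v ∧ Relation.ReflTransGen (Step S) b v

/-- The relators of a presentation, given by words, as elements of `F(X)`. -/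
def relators {X ℛ : Type*} (w : ℛ → Word X) : ℛ → FreeGroup X := fun ρ => FreeGroup.mk (w ρ)

/-- The element of `G` that a word represents. -/
def val {X ℛ : Type*} (w : ℛ → Word X) (u : Word X) : Grp (relators w) :=
  theta (relators w) (FreeGroup.mk u)

/-- `S` is a rewriting system for the presentation: the congruence which it generates on words
is equality in `G`. -/
def IsSystemFor {X ℛ : Type*} (w : ℛ → Word X) (S : Set (Word X × Word X)) : Prop :=
  ∀ u v, Relation.EqvGen (Step S) u v ↔ val w u = val w v

/-- `gt` is an admissible well-ordering of the words. -/
structure IsAdmissibleWellOrder {X : Type*} (gt : Word X → Word X → Prop) : Prop where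
  trans : ∀ a b c, gt a b → gt b c → gt a c
  total : ∀ a b, gt a b ∨ a = b ∨ gt b a
  wf : WellFounded fun a b => gt b a
  admissible : ∀ p q u v, gt p q → gt (u ++ p ++ v) (u ++ q ++ v)

/-- The presentation is completable with respect to `gt`: there is a finite complete rewriting
system for it whose rules are oriented by `gt`. -/
def Completable {X ℛ : Type*} (w : ℛ → Word X) (gt : Word X → Word X → Prop) : Prop :=
  ∃ S : Set (Word X × Word X), S.Finite ∧ (∀ p ∈ S, gt p.1 p.2) ∧ IsComplete S ∧ IsSystemFor w S

/-- `N` is the normal form function of `S`: `N g` is an irreducible word which represents `g`,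
and every word which represents `g` reduces to it. -/
structure IsNormalForm {X ℛ : Type*} (w : ℛ → Word X) (S : Set (Word X × Word X))
    (N : Grp (relators w) → Word X) : Prop where
  val_eq : ∀ g, val w (N g) = g
  irred : ∀ g, Irred S (N g)
  reduces : ∀ u, Relation.ReflTransGen (Step S) u (N (val w u))

end Rewriting

section ExtraInformation

/-- `Y`-sequences `(ρ₁, u₁)^ε₁ ⋯ (ρₖ, uₖ)^εₖ`; the sign `+` is `true`, and each `uᵢ : F(X)` is
given by a word. -/
abbrev YSeq (X ℛ : Type*) : Type _ := List ((ℛ × Word X) × Bool)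

/-- The element of `C(R)` that a `Y`-sequence represents. -/
def cls {X ℛ : Type*} (w : ℛ → Word X) (a : YSeq X ℛ) : C (relators w) :=
  (a.map fun y => cond y.2 (gen (relators w) y.1.1 (FreeGroup.mk y.1.2))
    (gen (relators w) y.1.1 (FreeGroup.mk y.1.2))⁻¹).prod

/-- The inverse of a `Y`-sequence. -/
def YSeq.inverse {X ℛ : Type*} (a : YSeq X ℛ) : YSeq X ℛ :=
  (a.map fun y => (y.1, !y.2)).reverse

/-- The action of a word on a `Y`-sequence. -/
def YSeq.act {X ℛ : Type*} (a : YSeq X ℛ) (u : Word X) : YSeq X ℛ :=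
  a.map fun y => ((y.1.1, y.1.2 ++ u), y.2)

/-- An extra information rule `(l, c, r)`. -/
abbrev Rule (X ℛ : Type*) : Type _ := Word X × YSeq X ℛ × Word X

/-- The rewriting system `R1` underlying `R2`. -/
def R1 {X ℛ : Type*} (R2 : List (Rule X ℛ)) : Set (Word X × Word X) :=
  {p | ∃ c, (p.1, c, p.2) ∈ R2}

/-- `R2` is an extra information rewriting system: `l = δ₂(c) r` for every rule `(l, c, r)`. -/
def IsEIRS {X ℛ : Type*} (w : ℛ → Word X) (R2 : List (Rule X ℛ)) : Prop :=
  ∀ l c r, (l, c, r) ∈ R2 →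
    FreeGroup.mk l = delta (relators w) (cls w c) * FreeGroup.mk r

/-- `R2` is a complete extra information rewriting system for the presentation. -/
structure IsCompleteEIRS {X ℛ : Type*} (w : ℛ → Word X) (R2 : List (Rule X ℛ)) : Prop where
  eirs : IsEIRS w R2
  complete : IsComplete (R1 R2)
  system : IsSystemFor w (R1 R2)

/-- All results of applying one rule of `R2` once to the word `z`: from `z = u l v` and the rule
`(l, c, r)` one gets `(c ^ (u⁻¹), u r v)`. -/
def redexes {X ℛ : Type*} [DecidableEq X] (R2 : List (Rule X ℛ)) (z : Word X) :
    List (YSeq X ℛ × Word X) :=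
  R2.flatMap fun p => (List.range (z.length + 1)).filterMap fun i =>
    if z.drop i = p.1 ++ z.drop (i + p.1.length) then
      some (p.2.1.act (FreeGroup.invRev (z.take i)),
        z.take i ++ p.2.2 ++ z.drop (i + p.1.length))
    else none

/-- One pass of the reduction loop on `(c, z)`: apply the first applicable rule, if there is
one, and record it. -/
def onePass {X ℛ : Type*} [DecidableEq X] (R2 : List (Rule X ℛ)) (s : YSeq X ℛ × Word X) :
    YSeq X ℛ × Word X :=
  match (redexes R2 s.2).head? with
  | none => s
  | some t => (s.1 ++ t.1, t.2)

open Classical in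
/-- `ReduceWord2`: repeat the pass, starting from `(id, z)`, until the word is irreducible. (The
value for a word on which this loop does not stop is irrelevant; there is no such word if the
rules are Noetherian.) -/
noncomputable def reduceWord2 {X ℛ : Type*} [DecidableEq X] (R2 : List (Rule X ℛ)) (z : Word X) :
    YSeq X ℛ × Word X :=
  if h : ∃ k, redexes R2 ((onePass R2)^[k] ([], z)).2 = [] then
    (onePass R2)^[Nat.find h] ([], z)
  else ([], z)

/-- The critical pairs of two rules `(l₁, c₁, r₁)` and `(l₂, c₂, r₂)`, with the recorded
information. First case, `u₁ l₁ v₁ = l₂`: the pair is `(u₁ r₁ v₁, r₂)`. Second case,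
`u₁ l₁ = l₂ v₂` with `u₁` shorter than `l₂`: the pair is `(u₁ r₁, r₂ v₂)`. -/
def criticalPairs {X ℛ : Type*} [DecidableEq X] (p q : Rule X ℛ) :
    List ((YSeq X ℛ × Word X) × (YSeq X ℛ × Word X)) :=
  ((redexes [p] q.1).map fun t => (t, (q.2.1, q.2.2))) ++
  (List.range q.1.length).filterMap fun i =>
    if p.1 = q.1.drop i ++ p.1.drop (q.1.length - i) then
      some ((p.2.1.act (FreeGroup.invRev (q.1.take i)), q.1.take i ++ p.2.2),
        (q.2.1, q.2.2 ++ p.1.drop (q.1.length - i)))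
    else none

open Classical in
/-- The rule, if any, which resolves a critical pair: both sides are reduced, to `z₁` and `z₂`,
and the larger one is rewritten to the smaller one. -/
noncomputable def resolve {X ℛ : Type*} [DecidableEq X] (gt : Word X → Word X → Prop)
    (R2 : List (Rule X ℛ)) (t : (YSeq X ℛ × Word X) × (YSeq X ℛ × Word X)) : List (Rule X ℛ) :=
  let d1 := reduceWord2 R2 t.1.2
  let d2 := reduceWord2 R2 t.2.2
  if gt d1.2 d2.2 then [(d1.2, (t.1.1 ++ d1.1).inverse ++ (t.2.1 ++ d2.1), d2.2)]
  else if gt d2.2 d1.2 then [(d2.2, (t.2.1 ++ d2.1).inverse ++ (t.1.1 ++ d1.1), d1.2)]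
  else []

/-- The rules which one pass of the completion procedure adds. -/
noncomputable def newRules {X ℛ : Type*} [DecidableEq X] (gt : Word X → Word X → Prop)
    (R2 : List (Rule X ℛ)) : List (Rule X ℛ) :=
  R2.flatMap fun p => R2.flatMap fun q => (criticalPairs p q).flatMap (resolve gt R2)

/-- One pass of the completion procedure. -/
noncomputable def onePassKB2 {X ℛ : Type*} [DecidableEq X] (gt : Word X → Word X → Prop)
    (R2 : List (Rule X ℛ)) : List (Rule X ℛ) := R2 ++ newRules gt R2

/-- The initial system of `grp⟨x₁, …, xₙ | w₁, …, wₘ⟩`: the rules `x x⁻¹ → id`, `x⁻¹ x → id` of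
the free group, with no extra information, and for each (nonempty) relator `ρ` the rule
`w ρ → id` with extra information `(ρ, id)`. -/
def initial {n m : ℕ} (w : Fin m → Word (Fin n)) : List (Rule (Fin n) (Fin m)) :=
  (List.finRange n).flatMap (fun x =>
    [([(x, true), (x, false)], [], []), ([(x, false), (x, true)], [], [])]) ++
  ((List.finRange m).filter fun ρ => !(w ρ).isEmpty).map fun ρ => (w ρ, [((ρ, []), true)], [])

/-- The extra information Knuth–Bendix procedure `KB2`: repeat the pass, from the initial system,
until there is nothing to add. It is undefined if this never happens. -/
noncomputable def KB2 {n m : ℕ} (w : Fin m → Word (Fin n))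
    (gt : Word (Fin n) → Word (Fin n) → Prop) : Part (List (Rule (Fin n) (Fin m))) :=
  (Nat.rfind fun k => Part.some (newRules gt ((onePassKB2 gt)^[k] (initial w))).isEmpty).map
    fun k => (onePassKB2 gt)^[k] (initial w)

end ExtraInformation

section Homotopy

/-- `h₀ g = [id, N g]⁻¹`. -/
def h0 {X ℛ : Type*} (w : ℛ → Word X) (N : Grp (relators w) → Word X)
    (hN : ∀ g, val w (N g) = g) (g : Cayley (relators w)) : g ⟶ ob (relators w) 1 :=
  Groupoid.inv (arr (relators w) (g := 1) (h := g) (FreeGroup.mk (N g))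
    (by rw [one_mul]; exact hN g))

/-- The first component of `ReduceWord2 (N(g) x N(g (θ x))⁻¹, R2)`, for an edge `[g, x]`. -/
noncomputable def edgeInfo {X ℛ : Type*} [DecidableEq X] (w : ℛ → Word X) (R2 : List (Rule X ℛ))
    (N : Grp (relators w) → Word X) (g : Grp (relators w)) (x : X) : YSeq X ℛ :=
  (reduceWord2 R2 (N g ++ [(x, true)] ++
    FreeGroup.invRev (N (g * val w [(x, true)])))).1

/-- `h₁ [g, x] = [id, ReduceWord2 (N(g) x N(g (θ x))⁻¹, R2)[1]]` on all edges of the Cayley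
graph. -/
def IsDeterminedBy {X ℛ : Type*} [DecidableEq X] (w : ℛ → Word X) (R2 : List (Rule X ℛ))
    (N : Grp (relators w) → Word X) (h1 : GroupoidHom (relators w)) : Prop :=
  ∀ g x, h1.map (edge (relators w) g x) = ⟨cls w (edgeInfo w R2 N g x)⟩

/-- The separation element `sep(g, ρ) = p₂ (h₁ δ̃₂ [g, ρ])⁻¹ ρ ^ (N g)⁻¹`. -/
def sep {X ℛ : Type*} (w : ℛ → Word X) (N : Grp (relators w) → Word X)
    (h1 : GroupoidHom (relators w)) (g : Grp (relators w)) (ρ : ℛ) : C (relators w) :=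
  (h1.map (deltaTilde (relators w) (⟨gen (relators w) ρ 1⟩ : CTilde (relators w) g))).p2⁻¹ *
    act (relators w) (FreeGroup.mk (N g))⁻¹ (gen (relators w) ρ 1)

/-- The subset `T` of `C(R)` consists of identities and generates the `ℤG`-module `π₂`. -/
def GeneratesPi2 {X ℛ : Type*} (w : ℛ → FreeGroup X) (T : Set (C w)) : Prop :=
  (∀ c ∈ T, delta w c = 1) ∧
  Submodule.span (MonoidAlgebra ℤ (Grp w)) {a : Pi2 w | a.val ∈ T} = ⊤

end Homotopy

section Encoding

/-! The data of a finite presentation, forgetting the bounds on the indices, as inputs and outputs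
of algorithms. -/

/-- Forget the bound on the generators in a word. -/
def rawWord {n : ℕ} (u : Word (Fin n)) : Word ℕ := u.map fun y => ((y.1 : ℕ), y.2)

/-- Forget the bounds on the generators and relators in a `Y`-sequence. -/
def rawYSeq {n m : ℕ} (a : YSeq (Fin n) (Fin m)) : YSeq ℕ ℕ :=
  a.map fun y => (((y.1.1 : ℕ), rawWord y.1.2), y.2)

/-- Forget the bounds on the generators and relators in a rule. -/
def rawRule {n m : ℕ} (p : Rule (Fin n) (Fin m)) : Rule ℕ ℕ :=
  (rawWord p.1, rawYSeq p.2.1, rawWord p.2.2)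

/-- A finite presentation as an input: the number of generators and the list of relators. -/
def rawPres {n m : ℕ} (w : Fin m → Word (Fin n)) : ℕ × List (Word ℕ) :=
  (n, List.ofFn fun ρ => rawWord (w ρ))

end Encoding

end IdRel

namespace IdRel

open Relation

/-! ### Abstract string rewriting: Newman's lemma, critical pairs, oriented systems. -/

section Rewriting

variable {X : Type*} {S T : Set (Word X × Word X)} {gt : Word X → Word X → Prop}

/-! Correctness of completion. Rules oriented by an admissible well-ordering are Noetherian, so
Newman's lemma and the critical pair lemma make an oriented system complete as soon as its critical
pairs are joinable. This is the case when a pass adds nothing (`IsOrientedSystem.isCompleteEIRS`).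
For termination, let `U` be the union of the rules of all passes. It is complete, because a critical
pair of two rules present at some pass is joined by the next pass. If `S` is a finite complete
system for the presentation oriented by the same order, the left side of each rule of `S` is
congruent to a smaller word, hence is reducible by `U`, hence by the rules of some pass. As `S` is
finite, one pass reduces all these left sides. Its irreducible words are then `S`-irreducible, so
each congruence class contains at most one of them; the two sides of a critical pair reduce to the
same word and nothing is added (`exists_newRules_eq_nil`).

The extra information is governed by one invariant, `Records`: a word `z` with record `c` and result
`r` satisfies `z = δ₂(c) r` in `F`. It is stable under contexts (first crossed module axiom), under
composition, and under resolving two results of one word (`Records.resolvent`). It also shows that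
new rules hold in `G`, so the congruence never changes.

Homotopy. A morphism on `F(X̃)` is freely determined by its values on edges; existence comes from a
homomorphism of the free group into a semidirect product. The word `N(g) x N(gθx)⁻¹` represents the
identity, so it reduces to the empty word and its record has exactly that word as boundary; the
formula for all arrows follows by multiplicativity. Now consider `c ↦ h₁[g, δ₂c]⁻¹ c^(N(g)⁻¹)`. Its
values lie in `π₂`, which is central in `C(R)`, so it is a homomorphism. For `g = 1` it fixes `π₂`
pointwise, hence is a retraction of `C(R)` onto `π₂`; it sends `(ρ, u)` to `sep(θ(u)⁻¹, ρ)`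
(`separation_gen`). The separation elements therefore generate `π₂`, even as an abelian group.

Computability. `reduceWord2` is replaced by a bounded number `k` of passes. Whether `k` suffices is
decidable, and all sufficient `k` give the same result, so an unbounded search for `k` computes the
right value. All data are encoded over `ℕ`; forgetting the bounds is injective and commutes with
every construction. -/

lemma Step.of_rule {l r : Word X} (h : (l, r) ∈ S) : Step S l r :=
  ⟨l, r, [], [], h, by simp, by simp⟩

lemma Step.context {a b : Word X} (h : Step S a b) (p q : Word X) :
    Step S (p ++ a ++ q) (p ++ b ++ q) := by
  obtain ⟨l, r, u, v, hlr, rfl, rfl⟩ := h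
  exact ⟨l, r, p ++ u, v ++ q, hlr, by simp, by simp⟩

lemma Step.mono (hST : S ⊆ T) {a b : Word X} (h : Step S a b) : Step T a b := by
  obtain ⟨l, r, u, v, hlr, h1, h2⟩ := h
  exact ⟨l, r, u, v, hST hlr, h1, h2⟩

lemma reflTransGen_context {a b : Word X} (h : ReflTransGen (Step S) a b) (p q : Word X) :
    ReflTransGen (Step S) (p ++ a ++ q) (p ++ b ++ q) :=
  h.lift (fun z => p ++ z ++ q) fun _ _ h => h.context p q

lemma reflTransGen_mono (hST : S ⊆ T) {a b : Word X} (h : ReflTransGen (Step S) a b) :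
    ReflTransGen (Step T) a b :=
  ReflTransGen.mono (fun _ _ h => Step.mono hST h) _ _ h

lemma eqvGen_context {a b : Word X} (h : EqvGen (Step S) a b) (p q : Word X) :
    EqvGen (Step S) (p ++ a ++ q) (p ++ b ++ q) := by
  induction h with
  | rel _ _ h => exact EqvGen.rel _ _ (h.context p q)
  | refl => exact EqvGen.refl _
  | symm _ _ _ ih => exact ih.symm
  | trans _ _ _ _ _ ih ih' => exact ih.trans _ _ _ ih'

lemma eqvGen_append {a b a' b' : Word X} (h : EqvGen (Step S) a b) (h' : EqvGen (Step S) a' b') :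
    EqvGen (Step S) (a ++ a') (b ++ b') := by
  have h1 := eqvGen_context h [] a'
  have h2 := eqvGen_context h' b []
  simp only [List.nil_append, List.append_nil] at h1 h2
  exact h1.trans _ _ _ h2

lemma eqvGen_mono (hST : S ⊆ T) {a b : Word X} (h : EqvGen (Step S) a b) :
    EqvGen (Step T) a b :=
  EqvGen.mono (fun _ _ h => Step.mono hST h) _ _ h

/-- The words `a` and `b` have a common reduct. -/
def Joinable (S : Set (Word X × Word X)) (a b : Word X) : Prop :=
  ∃ v, ReflTransGen (Step S) a v ∧ ReflTransGen (Step S) b v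

lemma Joinable.symm {a b : Word X} (h : Joinable S a b) : Joinable S b a :=
  let ⟨v, h1, h2⟩ := h
  ⟨v, h2, h1⟩

lemma Joinable.context {a b : Word X} (h : Joinable S a b) (p q : Word X) :
    Joinable S (p ++ a ++ q) (p ++ b ++ q) :=
  let ⟨_, h1, h2⟩ := h
  ⟨_, reflTransGen_context h1 p q, reflTransGen_context h2 p q⟩

lemma Joinable.mono (hST : S ⊆ T) {a b : Word X} (h : Joinable S a b) : Joinable T a b :=
  let ⟨_, h1, h2⟩ := h
  ⟨_, reflTransGen_mono hST h1, reflTransGen_mono hST h2⟩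

/-- Newman's lemma. -/
lemma joinable_of_locally_confluent (hwf : WellFounded fun a b => Step S b a)
    (hloc : ∀ t a b, Step S t a → Step S t b → Joinable S a b) (t a b : Word X)
    (ha : ReflTransGen (Step S) t a) (hb : ReflTransGen (Step S) t b) : Joinable S a b := by
  induction t using hwf.induction generalizing a b with
  | _ t ih =>
    rcases ReflTransGen.cases_head ha with rfl | ⟨a', hta, haa⟩
    · exact ⟨b, hb, .refl⟩
    rcases ReflTransGen.cases_head hb with rfl | ⟨b', htb, hbb⟩
    · exact ⟨a, .refl, ha⟩
    obtain ⟨c, hac, hbc⟩ := hloc t a' b' hta htb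
    obtain ⟨d, had, hcd⟩ := ih a' hta a c haa hac
    obtain ⟨e, hbe, hde⟩ := ih b' htb b d hbb (hbc.trans hcd)
    exact ⟨e, had.trans hde, hbe⟩

/-- The critical pairs of the rules in `S` have common reducts. -/
structure CriticalJoinable (S : Set (Word X × Word X)) : Prop where
  inclusion : ∀ s l r t r', (l, r) ∈ S → (s ++ l ++ t, r') ∈ S → Joinable S (s ++ r ++ t) r'
  overlap : ∀ s m t r r', m ≠ [] → (m ++ t, r) ∈ S → (s ++ m, r') ∈ S →
    Joinable S (s ++ r) (r' ++ t)

/-- The critical pair lemma. -/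
lemma CriticalJoinable.locally_confluent (h : CriticalJoinable S) (t a b : Word X)
    (ha : Step S t a) (hb : Step S t b) : Joinable S a b := by
  -- By symmetry one redex starts no later than the other; `s` is the part of the word between the
  -- two starting points. The redexes are then disjoint, nested, or properly overlapping.
  have key : ∀ l r l' r' u s v v' : Word X, (l, r) ∈ S → (l', r') ∈ S →
      l ++ v = s ++ l' ++ v' → Joinable S (u ++ r ++ v) (u ++ s ++ r' ++ v') := by
    intro l r l' r' u s v v' hl hl' e
    rw [List.append_assoc, List.append_eq_append_iff] at e
    rcases e with ⟨k, rfl, rfl⟩ | ⟨k, rfl, e⟩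
    · refine ⟨u ++ r ++ k ++ r' ++ v', .single ?_, .single ?_⟩
      · exact ⟨l', r', u ++ r ++ k, v', hl', by simp, by simp⟩
      · exact ⟨l, r, u, k ++ r' ++ v', hl, by simp, by simp⟩
    rw [List.append_eq_append_iff] at e
    rcases e with ⟨m, rfl, rfl⟩ | ⟨m, rfl, rfl⟩
    · have := (h.inclusion s l' r' m r hl' (by simpa using hl)).symm.context u v
      simpa using this
    -- An empty overlap means that the redexes are adjacent. No critical pair covers this case, but
    -- the two steps commute.
    · by_cases hk : k = []
      · subst hk
        refine ⟨u ++ r ++ r' ++ v', .single ?_, .single ?_⟩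
        · exact ⟨m, r', u ++ r, v', by simpa using hl', by simp, by simp⟩
        · exact ⟨s, r, u, r' ++ v', by simpa using hl, by simp, by simp⟩
      · have := (h.overlap s k m r' r hk hl' hl).symm.context u v'
        simpa using this
  obtain ⟨l, r, u, v, hl, rfl, rfl⟩ := ha
  obtain ⟨l', r', u', v', hl', e, rfl⟩ := hb
  rw [List.append_assoc, List.append_assoc, List.append_eq_append_iff] at e
  rcases e with ⟨s, rfl, e⟩ | ⟨s, rfl, e⟩
  · exact key l r l' r' u s v v' hl hl' (by simpa using e)
  · exact (key l' r' l r u' s v' v hl' hl (by simpa using e)).symm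

lemma Irred.eq_of_reflTransGen {a b : Word X} (h : Irred S a)
    (hab : ReflTransGen (Step S) a b) : a = b := by
  rcases ReflTransGen.cases_head hab with rfl | ⟨c, hc, _⟩
  · rfl
  · exact (h c hc).elim

lemma joinable_of_eqvGen
    (hc : ∀ t a b, ReflTransGen (Step S) t a → ReflTransGen (Step S) t b → Joinable S a b)
    {a b : Word X} (h : EqvGen (Step S) a b) : Joinable S a b := by
  induction h with
  | rel _ _ h => exact ⟨_, .single h, .refl⟩
  | refl => exact ⟨_, .refl, .refl⟩
  | symm _ _ _ ih => exact ih.symm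
  | trans _ _ _ _ _ ih ih' =>
    obtain ⟨v, h1, h2⟩ := ih
    obtain ⟨v', h3, h4⟩ := ih'
    obtain ⟨z, h5, h6⟩ := hc _ _ _ h2 h3
    exact ⟨z, h1.trans h5, h4.trans h6⟩

lemma IsComplete.eq_of_eqvGen (hS : IsComplete S) {a b : Word X} (ha : Irred S a)
    (hb : Irred S b) (h : EqvGen (Step S) a b) : a = b := by
  obtain ⟨v, h1, h2⟩ := joinable_of_eqvGen hS.2 h
  rw [ha.eq_of_reflTransGen h1, hb.eq_of_reflTransGen h2]

lemma Irred.of_append {a p q : Word X} (h : Irred S (p ++ a ++ q)) : Irred S a :=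
  fun _ hb => h _ (hb.context p q)

/-- A rule with empty left side `[] → r` would apply forever, giving the chain of powers of `r`.
This fact makes the normal form of the identity empty and starts the enumeration of irreducible
words. -/
lemma IsComplete.irred_nil (hS : IsComplete S) : Irred S [] := by
  rintro _ ⟨l, r, u, v, hl, e, rfl⟩
  obtain ⟨rfl, rfl, rfl⟩ : u = [] ∧ l = [] ∧ v = [] := by
    have := e.symm
    simp only [List.append_eq_nil_iff] at this
    tauto
  refine hS.1 ⟨fun i => (List.replicate i r).flatten, fun i => ?_⟩
  exact ⟨[], r, (List.replicate i r).flatten, [], hl, by simp, by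
    simp [List.replicate_succ']⟩

lemma IsAdmissibleWellOrder.irrefl (hgt : IsAdmissibleWellOrder gt) (a : Word X) : ¬ gt a a :=
  fun h => hgt.wf.asymmetric _ _ h h

lemma IsAdmissibleWellOrder.asymm (hgt : IsAdmissibleWellOrder gt) {a b : Word X} (h : gt a b) :
    ¬ gt b a := fun h' => hgt.irrefl a (hgt.trans _ _ _ h h')

/-- Were the empty word larger than `a`, the powers of `a` would descend forever. This orients all
rules of the initial system. -/
lemma IsAdmissibleWellOrder.gt_nil (hgt : IsAdmissibleWellOrder gt) {a : Word X} (ha : a ≠ []) :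
    gt a [] := by
  rcases hgt.total a [] with h | h | h
  · exact h
  · exact (ha h).elim
  · exfalso
    have key : ∀ z : Word X, ∀ i, z ≠ (List.replicate i a).flatten := by
      intro z
      induction z using hgt.wf.induction with
      | _ z ih =>
        rintro i rfl
        refine ih ((List.replicate (i + 1) a).flatten) ?_ (i + 1) rfl
        have := hgt.admissible _ _ (List.replicate i a).flatten [] h
        rw [List.replicate_succ']
        simpa using this
    exact key [] 0 (by simp)

/-- The rules of `S` are oriented by `gt`. -/
def Oriented (gt : Word X → Word X → Prop) (S : Set (Word X × Word X)) : Prop :=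
  ∀ p ∈ S, gt p.1 p.2

lemma Oriented.gt_of_step (hS : Oriented gt S) (hgt : IsAdmissibleWellOrder gt) {a b : Word X}
    (h : Step S a b) : gt a b := by
  obtain ⟨l, r, u, v, hl, rfl, rfl⟩ := h
  exact hgt.admissible _ _ _ _ (hS _ hl)

lemma Oriented.eq_or_gt (hS : Oriented gt S) (hgt : IsAdmissibleWellOrder gt) {a b : Word X}
    (h : ReflTransGen (Step S) a b) : a = b ∨ gt a b := by
  induction h with
  | refl => exact .inl rfl
  | tail _ h ih =>
    right
    rcases ih with rfl | ih
    · exact hS.gt_of_step hgt h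
    · exact hgt.trans _ _ _ ih (hS.gt_of_step hgt h)

lemma Oriented.wellFounded (hS : Oriented gt S) (hgt : IsAdmissibleWellOrder gt) :
    WellFounded fun a b => Step S b a :=
  Subrelation.wf (fun h => hS.gt_of_step hgt h) hgt.wf

lemma not_exists_chain (hwf : WellFounded fun a b => Step S b a) :
    ¬ ∃ t : ℕ → Word X, ∀ i, Step S (t i) (t (i + 1)) := by
  rintro ⟨t, ht⟩
  have key : ∀ z : Word X, ∀ i, t i ≠ z := by
    intro z
    induction z using hwf.induction with
    | _ z ih =>
      rintro i rfl
      exact ih _ (ht i) (i + 1) rfl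
  exact key _ 0 rfl

lemma isComplete_of_criticalJoinable (hS : Oriented gt S) (hgt : IsAdmissibleWellOrder gt)
    (h : CriticalJoinable S) : IsComplete S :=
  ⟨not_exists_chain (hS.wellFounded hgt),
    joinable_of_locally_confluent (hS.wellFounded hgt) h.locally_confluent⟩

/-- In a complete oriented system, a word which is not the least in its class is reducible. -/
lemma IsComplete.not_irred_of_gt (hc : IsComplete S) (hS : Oriented gt S)
    (hgt : IsAdmissibleWellOrder gt) {a b : Word X} (hab : gt a b)
    (h : EqvGen (Step S) a b) : ¬ Irred S a := by
  intro ha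
  obtain ⟨v, h1, h2⟩ := joinable_of_eqvGen hc.2 h
  -- If `a` were irreducible, the common reduct would be `a` itself, so `b` would reduce to `a` and
  -- could not be smaller.
  obtain rfl := ha.eq_of_reflTransGen h1
  rcases hS.eq_or_gt hgt h2 with rfl | h2
  · exact hgt.irrefl _ hab
  · exact hgt.asymm hab h2

end Rewriting

/-! ### Rewriting systems whose congruence is equality in the presented group. -/

section Presentation

variable {X ℛ : Type*} {w : ℛ → Word X}

@[simp] lemma val_append (w : ℛ → Word X) (u v : Word X) :
    val w (u ++ v) = val w u * val w v := by
  simp [val, ← FreeGroup.mul_mk]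

@[simp] lemma val_nil (w : ℛ → Word X) : val w [] = 1 := by
  simp [val, ← FreeGroup.one_eq_mk]

@[simp] lemma val_invRev (w : ℛ → Word X) (u : Word X) :
    val w (FreeGroup.invRev u) = (val w u)⁻¹ := by
  simp [val, ← FreeGroup.inv_mk]

lemma val_eq_of_eqvGen {S : Set (Word X × Word X)} (h : ∀ p ∈ S, val w p.1 = val w p.2)
    {a b : Word X} (hab : EqvGen (Step S) a b) : val w a = val w b := by
  induction hab with
  | rel _ _ h' =>
    obtain ⟨l, r, u, v, hl, rfl, rfl⟩ := h'
    have := h _ hl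
    simp_all
  | refl => rfl
  | symm _ _ _ ih => exact ih.symm
  | trans _ _ _ _ _ ih ih' => exact ih.trans ih'

/-- Equality in the free group is generated by cancelling adjacent inverse letters, and each such
cancellation is a step of `S`. -/
lemma eqvGen_of_red {S : Set (Word X × Word X)}
    (hS : ∀ (x : X) (b : Bool), ([(x, b), (x, !b)], []) ∈ S) {a b : Word X}
    (h : FreeGroup.mk a = FreeGroup.mk b) : EqvGen (Step S) a b := by
  rw [FreeGroup.Red.exact, ← FreeGroup.eqvGen_step_iff_join_red] at h
  refine EqvGen.mono ?_ _ _ h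
  rintro _ _ ⟨⟩
  exact ⟨_, _, _, _, hS _ _, by simp; rfl, by simp⟩

/-- The elements of `F` whose words are congruent to the empty word form a normal subgroup
containing the relators, hence containing the kernel of `θ`. -/
lemma isSystemFor_of_initial {S : Set (Word X × Word X)}
    (hval : ∀ p ∈ S, val w p.1 = val w p.2)
    (hS : ∀ (x : X) (b : Bool), ([(x, b), (x, !b)], []) ∈ S)
    (hw : ∀ ρ, w ρ ≠ [] → (w ρ, []) ∈ S) : IsSystemFor w S := by
  refine fun u v => ⟨val_eq_of_eqvGen hval, fun h => ?_⟩
  -- Quantifying over all words that represent `x` makes membership independent of the chosen word;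
  -- by `eqvGen_of_red` it is enough to check one of them.
  let K : Subgroup (FreeGroup X) :=
    { carrier := {x | ∀ z, FreeGroup.mk z = x → EqvGen (Step S) z []}
      one_mem' := fun z hz => eqvGen_of_red hS (by rw [hz, FreeGroup.one_eq_mk])
      mul_mem' := by
        rintro ⟨x⟩ ⟨y⟩ hx hy z hz
        have h1 : EqvGen (Step S) z (x ++ y) :=
          eqvGen_of_red hS (by rw [hz, ← FreeGroup.mul_mk]; rfl)
        exact h1.trans _ _ _ (eqvGen_append (hx x rfl) (hy y rfl))
      inv_mem' := by
        intro x hx z hz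
        have h1 := hx (FreeGroup.invRev z) (by rw [← FreeGroup.inv_mk, hz, inv_inv])
        have h2 := eqvGen_append (EqvGen.refl (r := Step S) z) h1
        rw [List.append_nil] at h2
        refine (h2.symm).trans _ _ _ (eqvGen_of_red hS ?_)
        simp [← FreeGroup.mul_mk, ← FreeGroup.inv_mk, FreeGroup.one_eq_mk] }
  have hK : K.Normal := by
    refine ⟨?_⟩
    rintro ⟨x⟩ hx ⟨y⟩ z hz
    have h1 : EqvGen (Step S) z (y ++ x ++ FreeGroup.invRev y) :=
      eqvGen_of_red hS (by rw [hz, ← FreeGroup.mul_mk, ← FreeGroup.mul_mk, ← FreeGroup.inv_mk]; rfl)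
    refine (h1.trans _ _ _ (eqvGen_context (hx x rfl) y (FreeGroup.invRev y))).trans _ _ _ ?_
    refine eqvGen_of_red hS ?_
    simp [← FreeGroup.mul_mk, ← FreeGroup.inv_mk, FreeGroup.one_eq_mk]
  have hle : Subgroup.normalClosure (Set.range (relators w)) ≤ K := by
    apply Subgroup.normalClosure_le_normal
    rintro _ ⟨ρ, rfl⟩ z hz
    refine (eqvGen_of_red hS hz).trans _ _ _ ?_
    by_cases hρ : w ρ = []
    · rw [hρ]
      exact EqvGen.refl _
    · exact EqvGen.rel _ _ (Step.of_rule (hw ρ hρ))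
  have huv : FreeGroup.mk (u ++ FreeGroup.invRev v) ∈
      Subgroup.normalClosure (Set.range (relators w)) := by
    have : theta (relators w) (FreeGroup.mk (u ++ FreeGroup.invRev v)) = 1 := by
      change val w _ = 1
      simp [h]
    exact (QuotientGroup.eq_one_iff _).1 this
  -- Here `u` is freely equal to `u v⁻¹ v`, and the factor `u v⁻¹` is congruent to the empty word.
  have h1 := eqvGen_append (hle huv _ rfl) (EqvGen.refl (r := Step S) v)
  refine (eqvGen_of_red hS ?_).trans _ _ _ h1
  simp [← FreeGroup.mul_mk, ← FreeGroup.inv_mk]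

/-- Further rules that hold in `G` cannot identify more words than `S` already does. This covers
single passes of completion and the union of all passes. -/
lemma IsSystemFor.mono {S T : Set (Word X × Word X)} (hS : IsSystemFor w S) (hST : S ⊆ T)
    (hT : ∀ p ∈ T, val w p.1 = val w p.2) : IsSystemFor w T :=
  fun u v => ⟨val_eq_of_eqvGen hT, fun h => eqvGen_mono hST ((hS u v).2 h)⟩

end Presentation

end IdRel

namespace IdRel

open Relation

/-! ### Recorded information, bounded reduction, and critical pairs. -/

section ExtraInformation

variable {X ℛ : Type*} {w : ℛ → Word X}

@[simp] lemma cls_nil (w : ℛ → Word X) : cls w [] = 1 := rfl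

@[simp] lemma cls_append (w : ℛ → Word X) (a b : YSeq X ℛ) :
    cls w (a ++ b) = cls w a * cls w b := by
  simp [cls]

lemma cls_cons (w : ℛ → Word X) (y : (ℛ × Word X) × Bool) (a : YSeq X ℛ) :
    cls w (y :: a) = cls w [y] * cls w a :=
  cls_append w [y] a

@[simp] lemma cls_inverse (w : ℛ → Word X) (a : YSeq X ℛ) :
    cls w a.inverse = (cls w a)⁻¹ := by
  induction a with
  | nil => simp [YSeq.inverse]
  | cons y a ih =>
    have h : YSeq.inverse (y :: a) = YSeq.inverse a ++ [(y.1, !y.2)] := by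
      simp [YSeq.inverse]
    rw [h, cls_append, ih, cls_cons w y a, mul_inv_rev]
    congr 1
    rcases y with ⟨y, _ | _⟩ <;> simp [cls]

@[simp] lemma cls_act (w : ℛ → Word X) (a : YSeq X ℛ) (u : Word X) :
    cls w (a.act u) = act (relators w) (FreeGroup.mk u) (cls w a) := by
  induction a with
  | nil => simp [YSeq.act]
  | cons y a ih =>
    have h : YSeq.act (y :: a) u = [((y.1.1, y.1.2 ++ u), y.2)] ++ YSeq.act a u := by
      simp [YSeq.act]
    rw [h, cls_append, ih, cls_cons w y a, map_mul]
    congr 1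
    rcases y with ⟨y, _ | _⟩ <;> simp [cls]

lemma mk_invRev (u : Word X) : FreeGroup.mk (FreeGroup.invRev u) = (FreeGroup.mk u)⁻¹ :=
  FreeGroup.inv_mk.symm

/-- The word `z` is `δ₂ s.1` times the word `s.2`. -/
def Records (w : ℛ → Word X) (z : Word X) (s : YSeq X ℛ × Word X) : Prop :=
  FreeGroup.mk z = delta (relators w) (cls w s.1) * FreeGroup.mk s.2

lemma Records.trans {z z' : Word X} {c d : YSeq X ℛ} {s : Word X} (h : Records w z (c, z'))
    (h' : Records w z' (d, s)) : Records w z (c ++ d, s) := by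
  simp only [Records, cls_append, map_mul] at *
  rw [h, h', mul_assoc]

lemma Records.val_eq {z : Word X} {s : YSeq X ℛ × Word X} (h : Records w z s) :
    val w z = val w s.2 := by
  rw [val, h, map_mul, theta_delta, one_mul]
  rfl

/-- Moving `u` across `δ₂(c)` conjugates it, and `u δ₂(c) u⁻¹ = δ₂(c^(u⁻¹))` by the first crossed
module axiom. This is the reason for the exponent `u⁻¹` in the record of a step. -/
lemma Records.context {l r : Word X} {c : YSeq X ℛ} (h : Records w l (c, r)) (u v : Word X) :
    Records w (u ++ l ++ v) (c.act (FreeGroup.invRev u), u ++ r ++ v) := by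
  simp only [Records] at *
  rw [cls_act, delta_act, mk_invRev, ← FreeGroup.mul_mk, ← FreeGroup.mul_mk, ← FreeGroup.mul_mk,
    ← FreeGroup.mul_mk, h]
  group

/-- From `δ₂(c) a = z = δ₂(d) b` one solves for `a`; this is the shape of the information attached
to a rule that resolves a critical pair. -/
lemma Records.resolvent {z a b : Word X} {c d : YSeq X ℛ} (h : Records w z (c, a))
    (h' : Records w z (d, b)) : Records w a (c.inverse ++ d, b) := by
  simp only [Records, cls_append, cls_inverse, map_mul, map_inv] at *
  rw [mul_assoc, ← h', h, inv_mul_cancel_left]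

lemma IsEIRS.val_eq {R2 : List (Rule X ℛ)} (h : IsEIRS w R2) :
    ∀ p ∈ R1 R2, val w p.1 = val w p.2 := by
  rintro ⟨l, r⟩ ⟨c, hc⟩
  exact Records.val_eq (s := (c, r)) (h l c r hc)

lemma R1_append (R R' : List (Rule X ℛ)) : R1 (R ++ R') = R1 R ∪ R1 R' := by
  ext p
  simp [R1, exists_or]

/-- `R2` has no infinite chain of reductions. -/
def Terminates (R2 : List (Rule X ℛ)) : Prop :=
  ¬ ∃ t : ℕ → Word X, ∀ i, Step (R1 R2) (t i) (t (i + 1))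

variable {R2 : List (Rule X ℛ)}

lemma Oriented.terminates {gt : Word X → Word X → Prop} (h : Oriented gt (R1 R2)) 
    (hgt : IsAdmissibleWellOrder gt) :
    Terminates R2 := not_exists_chain (h.wellFounded hgt)

variable [DecidableEq X]

lemma mem_redexes {z : Word X} {t : YSeq X ℛ × Word X} :
    t ∈ redexes R2 z ↔ ∃ l c r u v, (l, c, r) ∈ R2 ∧ z = u ++ l ++ v ∧
      t = (c.act (FreeGroup.invRev u), u ++ r ++ v) := by
  simp only [redexes, List.mem_flatMap, List.mem_filterMap, List.mem_range]
  constructor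
  · rintro ⟨⟨l, c, r⟩, hp, i, hi, h⟩
    split_ifs at h with h'
    simp only [Option.some.injEq] at h
    refine ⟨l, c, r, z.take i, z.drop (i + l.length), hp, ?_, h.symm⟩
    rw [List.append_assoc, ← h', List.take_append_drop]
  · rintro ⟨l, c, r, u, v, hp, rfl, rfl⟩
    refine ⟨(l, c, r), hp, u.length, by simp, ?_⟩
    simp [← List.drop_drop]

lemma step_of_mem_redexes {z : Word X} {t : YSeq X ℛ × Word X} (h : t ∈ redexes R2 z) :
    Step (R1 R2) z t.2 := by
  obtain ⟨l, c, r, u, v, hp, rfl, rfl⟩ := mem_redexes.1 h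
  exact ⟨l, r, u, v, ⟨c, hp⟩, rfl, rfl⟩

lemma records_of_mem_redexes (hR : IsEIRS w R2) {z : Word X} {t : YSeq X ℛ × Word X}
    (h : t ∈ redexes R2 z) : Records w z t := by
  obtain ⟨l, c, r, u, v, hp, rfl, rfl⟩ := mem_redexes.1 h
  exact Records.context (hR l c r hp) u v

lemma redexes_eq_nil_iff {z : Word X} : redexes R2 z = [] ↔ Irred (R1 R2) z := by
  rw [List.eq_nil_iff_forall_not_mem]
  constructor
  · rintro h _ ⟨l, r, u, v, ⟨c, hc⟩, rfl, rfl⟩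
    exact h _ (mem_redexes.2 ⟨l, c, r, u, v, hc, rfl, rfl⟩)
  · intro h t ht
    exact h _ (step_of_mem_redexes ht)

lemma onePass_cases (R2 : List (Rule X ℛ)) (s : YSeq X ℛ × Word X) :
    (redexes R2 s.2 = [] ∧ onePass R2 s = s) ∨
      ∃ t ∈ redexes R2 s.2, onePass R2 s = (s.1 ++ t.1, t.2) := by
  rcases h : redexes R2 s.2 with _ | ⟨t, ts⟩
  · exact .inl ⟨rfl, by simp [onePass, h]⟩
  · exact .inr ⟨t, by simp, by simp [onePass, h]⟩

/-- The result of `k` passes of the reduction loop on `z`. -/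
def reduceFuel (R2 : List (Rule X ℛ)) (k : ℕ) (z : Word X) : YSeq X ℛ × Word X :=
  (onePass R2)^[k] ([], z)

lemma reduceFuel_succ (R2 : List (Rule X ℛ)) (k : ℕ) (z : Word X) :
    reduceFuel R2 (k + 1) z = onePass R2 (reduceFuel R2 k z) :=
  Function.iterate_succ_apply' _ _ _

lemma reduceFuel_reduces (R2 : List (Rule X ℛ)) (k : ℕ) (z : Word X) :
    ReflTransGen (Step (R1 R2)) z (reduceFuel R2 k z).2 := by
  induction k with
  | zero => exact .refl
  | succ k ih =>
    rw [reduceFuel_succ]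
    rcases onePass_cases R2 (reduceFuel R2 k z) with ⟨_, h⟩ | ⟨t, ht, h⟩
    · rwa [h]
    · rw [h]
      exact ih.tail (step_of_mem_redexes (t := t) ht)

lemma reduceFuel_records (hR : IsEIRS w R2) (k : ℕ) (z : Word X) :
    Records w z (reduceFuel R2 k z) := by
  induction k with
  | zero => simp [Records, reduceFuel]
  | succ k ih =>
    rw [reduceFuel_succ]
    rcases onePass_cases R2 (reduceFuel R2 k z) with ⟨_, h⟩ | ⟨t, ht, h⟩
    · rwa [h]
    · rw [h]
      exact Records.trans (z' := (reduceFuel R2 k z).2) ih (records_of_mem_redexes hR ht)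

/-- Otherwise the successive results of the passes would be an infinite chain of reductions. -/
lemma Terminates.exists_fuel (hR : Terminates R2) (z : Word X) :
    ∃ k, redexes R2 (reduceFuel R2 k z).2 = [] := by
  by_contra! h
  refine hR ⟨fun k => (reduceFuel R2 k z).2, fun k => ?_⟩
  dsimp only
  rw [reduceFuel_succ]
  rcases onePass_cases R2 (reduceFuel R2 k z) with ⟨h', _⟩ | ⟨t, ht, h'⟩
  · exact (h k h').elim
  · rw [h']
    exact step_of_mem_redexes (t := t) ht

/-- A pass leaves a state with irreducible word unchanged, record included. Hence any sufficient
number of passes, not only the least one, yields `reduceWord2`. -/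
lemma reduceFuel_stable {k j : ℕ} {z : Word X} (h : redexes R2 (reduceFuel R2 k z).2 = [])
    (hkj : k ≤ j) : reduceFuel R2 j z = reduceFuel R2 k z := by
  induction j, hkj using Nat.le_induction with
  | base => rfl
  | succ j _ ih =>
    rw [reduceFuel_succ, ih]
    rcases onePass_cases R2 (reduceFuel R2 k z) with ⟨_, h'⟩ | ⟨t, ht, _⟩
    · exact h'
    · simp [h] at ht

lemma reduceWord2_eq {k : ℕ} {z : Word X} (h : redexes R2 (reduceFuel R2 k z).2 = []) :
    reduceWord2 R2 z = reduceFuel R2 k z := by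
  classical
  have hex : ∃ k, redexes R2 ((onePass R2)^[k] ([], z)).2 = [] := ⟨k, h⟩
  have hrw : reduceWord2 R2 z = reduceFuel R2 (Nat.find hex) z := by
    rw [reduceWord2, dif_pos hex]
    rfl
  rw [hrw]
  exact (reduceFuel_stable (Nat.find_spec hex) (Nat.find_le h)).symm

lemma Terminates.reduceWord2_irred (hR : Terminates R2) (z : Word X) :
    Irred (R1 R2) (reduceWord2 R2 z).2 := by
  obtain ⟨k, hk⟩ := hR.exists_fuel z
  rw [reduceWord2_eq hk]
  exact redexes_eq_nil_iff.1 hk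

lemma Terminates.reduceWord2_reduces (hR : Terminates R2) (z : Word X) :
    ReflTransGen (Step (R1 R2)) z (reduceWord2 R2 z).2 := by
  obtain ⟨k, hk⟩ := hR.exists_fuel z
  rw [reduceWord2_eq hk]
  exact reduceFuel_reduces R2 k z

lemma Terminates.reduceWord2_records (hR : Terminates R2) (h : IsEIRS w R2) (z : Word X) :
    Records w z (reduceWord2 R2 z) := by
  obtain ⟨k, hk⟩ := hR.exists_fuel z
  rw [reduceWord2_eq hk]
  exact reduceFuel_records h k z

/-- In the overlap case the index is the length of `u`; its being less than the length of the second
left side says precisely that the overlap `m` is nonempty. -/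
lemma mem_criticalPairs {p q : Rule X ℛ} {t : (YSeq X ℛ × Word X) × (YSeq X ℛ × Word X)} :
    t ∈ criticalPairs p q ↔
      (∃ u v, q.1 = u ++ p.1 ++ v ∧
        t = ((p.2.1.act (FreeGroup.invRev u), u ++ p.2.2 ++ v), (q.2.1, q.2.2))) ∨
      (∃ u m v, m ≠ [] ∧ p.1 = m ++ v ∧ q.1 = u ++ m ∧
        t = ((p.2.1.act (FreeGroup.invRev u), u ++ p.2.2), (q.2.1, q.2.2 ++ v))) := by
  rw [criticalPairs, List.mem_append]
  refine or_congr ?_ ?_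
  · simp only [List.mem_map, mem_redexes, List.mem_singleton]
    constructor
    · rintro ⟨_, ⟨l, c, r, u, v, rfl, h, rfl⟩, rfl⟩
      exact ⟨u, v, h, rfl⟩
    · rintro ⟨u, v, h, rfl⟩
      exact ⟨_, ⟨p.1, p.2.1, p.2.2, u, v, rfl, h, rfl⟩, rfl⟩
  · simp only [List.mem_filterMap, List.mem_range]
    constructor
    · rintro ⟨i, hi, h⟩
      split_ifs at h with h'
      simp only [Option.some.injEq] at h
      refine ⟨q.1.take i, q.1.drop i, _, ?_, h', (List.take_append_drop _ _).symm, h.symm⟩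
      rw [Ne, List.drop_eq_nil_iff]
      omega
    · rintro ⟨u, m, v, hm, hp, hq, rfl⟩
      have := List.length_pos_iff.2 hm
      refine ⟨u.length, by simp [hq, this], ?_⟩
      simp [hp, hq]

/-- A critical pair of rules comes from a word which both rules rewrite. -/
lemma exists_records_of_mem_criticalPairs (hR : IsEIRS w R2) {p q : Rule X ℛ} (hp : p ∈ R2)
    (hq : q ∈ R2) {t : (YSeq X ℛ × Word X) × (YSeq X ℛ × Word X)} (ht : t ∈ criticalPairs p q) :
    ∃ z, Records w z t.1 ∧ Records w z t.2 := by
  obtain ⟨l, c, r⟩ := p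
  obtain ⟨l', c', r'⟩ := q
  rcases mem_criticalPairs.1 ht with ⟨u, v, h, rfl⟩ | ⟨u, m, v, hm, h1, h2, rfl⟩
  · refine ⟨u ++ l ++ v, Records.context (hR l c r hp) u v, ?_⟩
    dsimp only at h
    rw [← h]
    exact hR l' c' r' hq
  · dsimp only at h1 h2
    refine ⟨u ++ l, ?_, ?_⟩
    · have := Records.context (hR l c r hp) u []
      simpa using this
    · have := Records.context (hR l' c' r' hq) [] v
      rw [h1, ← List.append_assoc, ← h2]
      simpa [YSeq.act] using this

/-- All critical pairs of `R2` resolve, as far as some set `S` of rules is concerned. -/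
lemma criticalJoinable_of_forall {S : Set (Word X × Word X)}
    (h : ∀ p ∈ S, ∀ q ∈ S, ∃ R : List (Rule X ℛ), ∃ p' ∈ R, ∃ q' ∈ R,
      p = (p'.1, p'.2.2) ∧ q = (q'.1, q'.2.2) ∧
      ∀ t ∈ criticalPairs p' q', Joinable S t.1.2 t.2.2) : CriticalJoinable S where
  inclusion s l r t r' hl hl' := by
    obtain ⟨R, ⟨l1, c1, r1⟩, _, ⟨l2, c2, r2⟩, _, e1, e2, hR⟩ := h _ hl _ hl'
    simp only [Prod.mk.injEq] at e1 e2
    obtain ⟨rfl, rfl⟩ := e1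
    obtain ⟨rfl, rfl⟩ := e2
    exact hR _ (mem_criticalPairs.2 (.inl ⟨s, t, rfl, rfl⟩))
  overlap s m t r r' hm hl hl' := by
    obtain ⟨R, ⟨l1, c1, r1⟩, _, ⟨l2, c2, r2⟩, _, e1, e2, hR⟩ := h _ hl _ hl'
    simp only [Prod.mk.injEq] at e1 e2
    obtain ⟨rfl, rfl⟩ := e1
    obtain ⟨rfl, rfl⟩ := e2
    exact hR _ (mem_criticalPairs.2 (.inr ⟨s, m, t, hm, rfl, rfl, rfl⟩))

end ExtraInformation

/-! ### Correctness and termination of the completion procedure. -/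

section Completion

variable {X ℛ : Type*} [DecidableEq X] {w : ℛ → Word X} {gt : Word X → Word X → Prop}
  {R2 : List (Rule X ℛ)}

lemma mem_resolve (hR : Terminates R2) (hE : IsEIRS w R2)
    {t : (YSeq X ℛ × Word X) × (YSeq X ℛ × Word X)} {z : Word X} (h1 : Records w z t.1)
    (h2 : Records w z t.2) {p : Rule X ℛ} (hp : p ∈ resolve gt R2 t) :
    gt p.1 p.2.2 ∧ Records w p.1 (p.2.1, p.2.2) := by
  have e1 := Records.trans (z' := t.1.2) h1 (hR.reduceWord2_records hE t.1.2)
  have e2 := Records.trans (z' := t.2.2) h2 (hR.reduceWord2_records hE t.2.2)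
  simp only [resolve] at hp
  split_ifs at hp with hg hg'
  · obtain rfl := List.mem_singleton.1 hp
    exact ⟨hg, e1.resolvent e2⟩
  · obtain rfl := List.mem_singleton.1 hp
    exact ⟨hg', e2.resolvent e1⟩
  · simp at hp

lemma mem_newRules {gt : Word X → Word X → Prop} {p : Rule X ℛ} : p ∈ newRules gt R2 ↔
    ∃ q ∈ R2, ∃ q' ∈ R2, ∃ t ∈ criticalPairs q q', p ∈ resolve gt R2 t := by
  simp [newRules]

lemma mem_newRules_spec (hR : Terminates R2) (hE : IsEIRS w R2) {p : Rule X ℛ}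
    (hp : p ∈ newRules gt R2) : gt p.1 p.2.2 ∧ Records w p.1 (p.2.1, p.2.2) := by
  obtain ⟨q, hq, q', hq', t, ht, hp⟩ := mem_newRules.1 hp
  obtain ⟨z, h1, h2⟩ := exists_records_of_mem_criticalPairs hE hq hq' ht
  exact mem_resolve hR hE h1 h2 hp

/-- Oriented extra information rewriting systems for a presentation. -/
structure IsOrientedSystem (w : ℛ → Word X) (gt : Word X → Word X → Prop)
    (R2 : List (Rule X ℛ)) : Prop where
  eirs : IsEIRS w R2
  oriented : Oriented gt (R1 R2)
  system : IsSystemFor w (R1 R2)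

lemma IsOrientedSystem.onePassKB2 (hgt : IsAdmissibleWellOrder gt)
    (h : IsOrientedSystem w gt R2) : IsOrientedSystem w gt (onePassKB2 gt R2) := by
  have key := fun p => mem_newRules_spec (p := p) (gt := gt) (h.oriented.terminates hgt) h.eirs
  have heirs : IsEIRS w (IdRel.onePassKB2 gt R2) := by
    intro l c r hl
    rcases List.mem_append.1 hl with hl | hl
    · exact h.eirs l c r hl
    · exact (key _ hl).2
  refine ⟨heirs, ?_, h.system.mono ?_ heirs.val_eq⟩
  · rintro ⟨l, r⟩ ⟨c, hl⟩
    rcases List.mem_append.1 hl with hl | hl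
    · exact h.oriented _ ⟨c, hl⟩
    · exact (key _ hl).1
  · rw [IdRel.onePassKB2, R1_append]
    exact Set.subset_union_left

/-- The reduced sides are equal or comparable, because the order is total; in the latter case the
added rule rewrites the larger to the smaller in one step. -/
lemma IsOrientedSystem.joinable_onePassKB2 (hgt : IsAdmissibleWellOrder gt)
    (h : IsOrientedSystem w gt R2) {p q : Rule X ℛ} (hp : p ∈ R2) (hq : q ∈ R2)
    {t : (YSeq X ℛ × Word X) × (YSeq X ℛ × Word X)} (ht : t ∈ criticalPairs p q) :
    Joinable (R1 (IdRel.onePassKB2 gt R2)) t.1.2 t.2.2 := by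
  have hT := h.oriented.terminates hgt
  have hsub : R1 R2 ⊆ R1 (IdRel.onePassKB2 gt R2) := by
    rw [IdRel.onePassKB2, R1_append]
    exact Set.subset_union_left
  have hnew : ∀ l c r, (l, c, r) ∈ resolve gt R2 t → Step (R1 (IdRel.onePassKB2 gt R2)) l r :=
    fun l c r hs => Step.of_rule
      ⟨c, List.mem_append_right _ (mem_newRules.2 ⟨p, hp, q, hq, t, ht, hs⟩)⟩
  have e1 := reflTransGen_mono hsub (hT.reduceWord2_reduces t.1.2)
  have e2 := reflTransGen_mono hsub (hT.reduceWord2_reduces t.2.2)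
  rcases hgt.total (reduceWord2 R2 t.1.2).2 (reduceWord2 R2 t.2.2).2 with hg | hg | hg
  · refine ⟨_, e1.tail (hnew _ ((t.1.1 ++ (reduceWord2 R2 t.1.2).1).inverse ++
      (t.2.1 ++ (reduceWord2 R2 t.2.2).1)) _ ?_), e2⟩
    simp [resolve, hg]
  · rw [hg] at e1
    exact ⟨_, e1, e2⟩
  · refine ⟨_, e1, e2.tail (hnew _ ((t.2.1 ++ (reduceWord2 R2 t.2.2).1).inverse ++
      (t.1.1 ++ (reduceWord2 R2 t.1.2).1)) _ ?_)⟩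
    simp [resolve, hg, hgt.asymm hg]

/-- If a pass adds nothing, then the system is complete. -/
lemma IsOrientedSystem.isCompleteEIRS (hgt : IsAdmissibleWellOrder gt)
    (h : IsOrientedSystem w gt R2) (hnew : newRules gt R2 = []) : IsCompleteEIRS w R2 := by
  refine ⟨h.eirs, isComplete_of_criticalJoinable h.oriented hgt ?_, h.system⟩
  refine criticalJoinable_of_forall (ℛ := ℛ) ?_
  rintro ⟨l, r⟩ ⟨c, hc⟩ ⟨l', r'⟩ ⟨c', hc'⟩
  refine ⟨R2, _, hc, _, hc', rfl, rfl, fun t ht => ?_⟩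
  have := h.joinable_onePassKB2 hgt hc hc' ht
  rwa [IdRel.onePassKB2, hnew, List.append_nil] at this

/-- If every rule of some complete oriented system has a reducible left hand side, then a pass adds
nothing. -/
lemma IsOrientedSystem.newRules_eq_nil (hgt : IsAdmissibleWellOrder gt)
    (h : IsOrientedSystem w gt R2) {S : Set (Word X × Word X)} (hS : IsComplete S)
    (hSw : IsSystemFor w S) (hred : ∀ p ∈ S, ¬ Irred (R1 R2) p.1) :
    newRules gt R2 = [] := by
  have hT := h.oriented.terminates hgt
  -- An `S`-redex in `z` would be a left side of `S`, which is reducible by hypothesis and would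
  -- make `z` reducible.
  have hirr : ∀ z, Irred (R1 R2) z → Irred S z := by
    rintro z hz _ ⟨l, r, u, v, hl, rfl, rfl⟩
    exact hred _ hl hz.of_append
  rw [List.eq_nil_iff_forall_not_mem]
  intro s hs
  obtain ⟨p, hp, q, hq, t, ht, hs⟩ := mem_newRules.1 hs
  obtain ⟨z, h1, h2⟩ := exists_records_of_mem_criticalPairs h.eirs hp hq ht
  -- Both sides represent the same element of `G` as the common word `z`, and a complete system for
  -- `G` has only one irreducible word per element.
  have e : (reduceWord2 R2 t.1.2).2 = (reduceWord2 R2 t.2.2).2 := by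
    refine hS.eq_of_eqvGen (hirr _ (hT.reduceWord2_irred _)) (hirr _ (hT.reduceWord2_irred _)) ?_
    rw [hSw, ← (hT.reduceWord2_records h.eirs t.1.2).val_eq,
      ← (hT.reduceWord2_records h.eirs t.2.2).val_eq, ← h1.val_eq, ← h2.val_eq]
  simp only [resolve, e, hgt.irrefl, if_false] at hs
  exact List.not_mem_nil hs

variable {n m : ℕ} {w : Fin m → Word (Fin n)} {gt : Word (Fin n) → Word (Fin n) → Prop}

lemma mem_initial {p : Rule (Fin n) (Fin m)} : p ∈ initial w ↔
    (∃ x b, p = ([(x, b), (x, !b)], [], [])) ∨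
      ∃ ρ, w ρ ≠ [] ∧ p = (w ρ, [((ρ, []), true)], []) := by
  simp only [initial, List.mem_append, List.mem_flatMap, List.mem_finRange, true_and,
    List.mem_cons, List.not_mem_nil, or_false, List.mem_map, List.mem_filter, Bool.exists_bool,
    Bool.not_eq_true', List.isEmpty_eq_false_iff, Bool.not_false, Bool.not_true]
  refine or_congr (exists_congr fun x => or_comm) (exists_congr fun ρ => ?_)
  rw [eq_comm (a := p)]

lemma isOrientedSystem_initial (hgt : IsAdmissibleWellOrder gt) :
    IsOrientedSystem w gt (initial w) := by
  have heirs : IsEIRS w (initial w) := by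
    intro l c r hl
    rcases mem_initial.1 hl with ⟨x, b, h⟩ | ⟨ρ, _, h⟩ <;> simp only [Prod.mk.injEq] at h <;>
      obtain ⟨rfl, rfl, rfl⟩ := h
    · have : FreeGroup.mk [(x, b), (x, !b)] = FreeGroup.mk [] :=
        Quot.sound (FreeGroup.Red.Step.cons_not)
      simp [this]
    · simp [cls, relators, ← FreeGroup.one_eq_mk]
  refine ⟨heirs, ?_, isSystemFor_of_initial heirs.val_eq ?_ ?_⟩
  · rintro ⟨l, r⟩ ⟨c, hl⟩
    rcases mem_initial.1 hl with ⟨x, b, h⟩ | ⟨ρ, hρ, h⟩ <;> simp only [Prod.mk.injEq] at h <;>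
      obtain ⟨rfl, rfl, rfl⟩ := h
    · exact hgt.gt_nil (by simp)
    · exact hgt.gt_nil hρ
  · exact fun x b => ⟨[], mem_initial.2 (.inl ⟨x, b, rfl⟩)⟩
  · exact fun ρ hρ => ⟨_, mem_initial.2 (.inr ⟨ρ, hρ, rfl⟩)⟩

/-- The system after `k` passes of the completion procedure. -/
noncomputable def iterateKB2 (w : Fin m → Word (Fin n))
    (gt : Word (Fin n) → Word (Fin n) → Prop) (k : ℕ) : List (Rule (Fin n) (Fin m)) :=
  (onePassKB2 gt)^[k] (initial w)

lemma iterateKB2_succ (k : ℕ) :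
    iterateKB2 w gt (k + 1) = onePassKB2 gt (iterateKB2 w gt k) :=
  Function.iterate_succ_apply' _ _ _

lemma isOrientedSystem_iterateKB2 (hgt : IsAdmissibleWellOrder gt) (k : ℕ) :
    IsOrientedSystem w gt (iterateKB2 w gt k) := by
  induction k with
  | zero => exact isOrientedSystem_initial hgt
  | succ k ih =>
    rw [iterateKB2_succ]
    exact ih.onePassKB2 hgt

lemma iterateKB2_mono : Monotone fun k => {p | p ∈ iterateKB2 w gt k} := by
  refine monotone_nat_of_le_succ fun k p hp => ?_
  simp only [Set.mem_ofPred_eq, iterateKB2_succ] at *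
  exact List.mem_append_left _ hp

lemma R1_iterateKB2_mono : Monotone fun k => R1 (iterateKB2 w gt k) := by
  rintro i j hij p ⟨c, hc⟩
  exact ⟨c, iterateKB2_mono hij hc⟩

/-- The limit of the passes is complete whether or not the passes stabilise. Comparing it with a
finite complete system then forces a finite stage at which nothing is added. -/
lemma exists_newRules_eq_nil (hgt : IsAdmissibleWellOrder gt) (hw : Completable w gt) :
    ∃ k, newRules gt (iterateKB2 w gt k) = [] := by
  obtain ⟨S, hfin, hSgt, hS, hSw⟩ := hw
  have hor := isOrientedSystem_iterateKB2 (w := w) hgt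
  let U : Set (Word (Fin n) × Word (Fin n)) := ⋃ k, R1 (iterateKB2 w gt k)
  have hsub : ∀ k, R1 (iterateKB2 w gt k) ⊆ U :=
    fun k => Set.subset_iUnion (fun k => R1 (iterateKB2 w gt k)) k
  have hU : Oriented gt U := by
    rintro p hp
    obtain ⟨k, hk⟩ := Set.mem_iUnion.1 hp
    exact (hor k).oriented p hk
  have hUw : IsSystemFor w U := by
    refine (hor 0).system.mono (hsub 0) fun p hp => ?_
    obtain ⟨k, hk⟩ := Set.mem_iUnion.1 hp
    exact (hor k).eirs.val_eq p hk
  have hUc : IsComplete U := by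
    refine isComplete_of_criticalJoinable hU hgt (criticalJoinable_of_forall (ℛ := Fin m) ?_)
    rintro ⟨l, r⟩ hl ⟨l', r'⟩ hl'
    obtain ⟨i, hi⟩ := Set.mem_iUnion.1 hl
    obtain ⟨j, hj⟩ := Set.mem_iUnion.1 hl'
    obtain ⟨c, hc⟩ := R1_iterateKB2_mono (le_max_left i j) hi
    obtain ⟨c', hc'⟩ := R1_iterateKB2_mono (le_max_right i j) hj
    -- Rules are never discarded, so two rules of `U` coexist at pass `max i j`, and the following
    -- pass joins their critical pairs.
    refine ⟨iterateKB2 w gt (max i j), _, hc, _, hc', rfl, rfl, fun t ht => ?_⟩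
    refine Joinable.mono (hsub (max i j + 1)) ?_
    rw [iterateKB2_succ]
    exact (hor _).joinable_onePassKB2 hgt hc hc' ht
  have hex : ∀ p ∈ S, ∃ k, ¬ Irred (R1 (iterateKB2 w gt k)) p.1 := by
    intro p hp
    -- Both `S` and `U` generate equality in `G`.
    have h1 : EqvGen (Step U) p.1 p.2 := by
      rw [hUw, ← hSw]
      exact EqvGen.rel _ _ (Step.of_rule hp)
    have h2 := hUc.not_irred_of_gt hU hgt (hSgt p hp) h1
    simp only [Irred, not_forall, not_not] at h2
    obtain ⟨b, l, r, u, v, hl, e⟩ := h2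
    obtain ⟨k, hk⟩ := Set.mem_iUnion.1 hl
    exact ⟨k, fun h => h b ⟨l, r, u, v, hk, e⟩⟩
  choose! f hf using hex
  -- This is where finiteness of `S` enters; a left side that is reducible at pass `f p` remains so
  -- at pass `K`.
  obtain ⟨K, hK⟩ := (hfin.image f).bddAbove
  refine ⟨K, (hor K).newRules_eq_nil hgt hS hSw fun p hp h => hf p hp fun b hb => ?_⟩
  exact h b (hb.mono (R1_iterateKB2_mono (hK ⟨p, hp, rfl⟩)))

/-- `KB2` stops at the first pass which adds nothing. -/
lemma exists_mem_KB2 (hgt : IsAdmissibleWellOrder gt) (hw : Completable w gt) :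
    ∃ k, KB2 w gt = Part.some (iterateKB2 w gt k) ∧ newRules gt (iterateKB2 w gt k) = [] ∧
      ∀ j < k, newRules gt (iterateKB2 w gt j) ≠ [] := by
  classical
  have hex := exists_newRules_eq_nil hgt hw
  refine ⟨Nat.find hex, ?_, Nat.find_spec hex, fun j hj => Nat.find_min hex hj⟩
  rw [Part.eq_some_iff, KB2, Part.mem_map_iff]
  refine ⟨Nat.find hex, Nat.mem_rfind.2 ⟨?_, fun {j} hj => ?_⟩, rfl⟩
  · have := Nat.find_spec hex
    simpa [iterateKB2] using this
  · have := Nat.find_min hex hj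
    simpa [iterateKB2] using this

end Completion

end IdRel

namespace IdRel

open Relation CategoryTheory

/-! ### Morphisms on the Cayley groupoid and their values on edges. -/

section Groupoid

variable {X ℛ : Type*} {w : ℛ → FreeGroup X}

@[simp] lemma CTilde.p2_mul {g : Grp w} (a b : CTilde w g) : (a * b).p2 = a.p2 * b.p2 := rfl

/-- The value `p₂ (h [g, u])` of a morphism `h` on the arrow `[g, u]`. -/
def GroupoidHom.value (h : GroupoidHom w) (g : Grp w) (u : FreeGroup X) : C w :=
  (h.map (arr w (g := g) u rfl)).p2

/-- The target of an arrow is determined by its source and its element of `F`, so the equation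
carried by the arrow can be eliminated. -/
lemma Cayley.induction {motive : ∀ g k : Cayley w, (g ⟶ k) → Prop}
    (h : ∀ (g : Grp w) (u : FreeGroup X), motive (ob w g) (ob w (g * theta w u)) (arr w u rfl))
    {g k : Cayley w} (f : g ⟶ k) : motive g k f := by
  obtain ⟨u, e⟩ := f
  have e' : Mul.mul (α := Grp w) g (theta w u) = k := e
  subst e'
  exact h g u

lemma GroupoidHom.p2_map (h : GroupoidHom w) {g k : Cayley w} (f : g ⟶ k) :
    (h.map f).p2 = h.value g f.1 := by
  induction f using Cayley.induction with
  | h g u => rfl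

lemma GroupoidHom.value_mul (h : GroupoidHom w) (g : Grp w) (u v : FreeGroup X) :
    h.value g (u * v) = h.value g u * h.value (g * theta w u) v := by
  have e := h.map_comp (arr w (g := g) u rfl) (arr w (g := g * theta w u) v rfl)
  have e' := congrArg CTilde.p2 e
  rw [p2_map, CTilde.p2_mul, p2_map, p2_map] at e'
  exact e'

@[simp] lemma GroupoidHom.value_one (h : GroupoidHom w) (g : Grp w) : h.value g 1 = 1 := by
  have e := h.value_mul g 1 1
  rwa [map_one, mul_one, mul_one, left_eq_mul] at e

lemma GroupoidHom.value_inv (h : GroupoidHom w) (g : Grp w) (u : FreeGroup X) :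
    h.value g u⁻¹ = (h.value (g * (theta w u)⁻¹) u)⁻¹ := by
  have e := h.value_mul g u⁻¹ u
  rw [inv_mul_cancel, value_one, map_inv] at e
  exact eq_inv_of_mul_eq_one_left e.symm

/-- The groupoid is generated by the edges: a letter `x⁻¹` at `g` is the inverse of the edge `x`
that ends at `g`. -/
lemma GroupoidHom.ext_value {h h' : GroupoidHom w}
    (e : ∀ g x, h.value g (FreeGroup.of x) = h'.value g (FreeGroup.of x)) : h = h' := by
  have key : ∀ u g, h.value g u = h'.value g u := by
    intro u
    induction u using FreeGroup.induction_on with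
    | C1 => simp
    | of x => exact fun g => e g x
    | inv_of x _ => intro g; rw [value_inv, value_inv, e]
    | mul u v hu hv => intro g; rw [value_mul, value_mul, hu, hv]
  ext g k f
  rw [p2_map, p2_map]
  exact key _ _

/-- The action of `G` on functions on `G` by right translation. -/
def translation (G H : Type*) [Group G] [Group H] : G →* MulAut (G → H) where
  toFun g :=
    { toFun := fun b k => b (k * g)
      invFun := fun b k => b (k * g⁻¹)
      left_inv := fun b => by simp
      right_inv := fun b => by simp
      map_mul' := fun _ _ => rfl }
  map_one' := by ext; simp
  map_mul' g g' := by ext; simp [mul_assoc]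

/-- The crossed homomorphism from the free group with prescribed values on the edges. -/
def crossedHom (w : ℛ → FreeGroup X) (e : Grp w → X → C w) :
    FreeGroup X →* (Grp w → C w) ⋊[translation (Grp w) (C w)] Grp w :=
  FreeGroup.lift fun x => ⟨fun g => e g x, theta w (FreeGroup.of x)⟩

lemma crossedHom_right (e : Grp w → X → C w) (u : FreeGroup X) :
    (crossedHom w e u).right = theta w u := by
  have : SemidirectProduct.rightHom.comp (crossedHom w e) = theta w :=
    FreeGroup.ext_hom _ _ fun x => by simp [crossedHom]
  exact DFunLike.congr_fun this u

/-- The morphism of groupoids with prescribed values on the edges of the Cayley graph. -/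
def GroupoidHom.ofEdges (w : ℛ → FreeGroup X) (e : Grp w → X → C w) : GroupoidHom w where
  map {g _} f := ⟨(crossedHom w e f.1).left g⟩
  map_comp := by
    intro g k l f f'
    induction f using Cayley.induction with
    | h g u => ?_
    ext
    -- Multiplication in the semidirect product translates the second function by `θ(u)`, which
    -- moves the base point of the second arrow to the end of the first.
    change (crossedHom w e (u * f'.1)).left g = _ * (crossedHom w e f'.1).left (g * theta w u)
    rw [map_mul, SemidirectProduct.mul_left, crossedHom_right]
    rfl

lemma GroupoidHom.ofEdges_value (e : Grp w → X → C w) (g : Grp w) (x : X) :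
    (GroupoidHom.ofEdges w e).value g (FreeGroup.of x) = e g x := by
  change (crossedHom w e (FreeGroup.of x)).left g = _
  simp [crossedHom]

/-- Along a composite of arrows the inner factors `N` cancel, so the formula propagates from edges
to all arrows. -/
lemma GroupoidHom.delta_value {h : GroupoidHom w} {N : Grp w → FreeGroup X}
    (hN : ∀ g x, delta w (h.value g (FreeGroup.of x)) =
      N g * FreeGroup.of x * (N (g * theta w (FreeGroup.of x)))⁻¹) (g : Grp w)
    (u : FreeGroup X) : delta w (h.value g u) = N g * u * (N (g * theta w u))⁻¹ := by
  induction u using FreeGroup.induction_on generalizing g with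
  | C1 => simp
  | of x => exact hN g x
  | inv_of x _ =>
    rw [value_inv, map_inv, hN, map_inv, inv_mul_cancel_right]
    group
  | mul u v hu hv =>
    rw [value_mul, map_mul, hu, hv, map_mul, mul_assoc g]
    group

/-- By the Peiffer rule, conjugation by `z` is the action of `δ₂(z) = 1`: identities are central in
`C(R)`. -/
lemma mul_comm_of_delta_eq_one {z : C w} (hz : delta w z = 1) (c : C w) : z * c = c * z := by
  have h := peiffer_rule w z c
  rw [hz, act_one, mul_assoc, inv_mul_eq_iff_eq_mul] at h
  exact h.symm

/-- The map `c ↦ h [g, δ₂ c]⁻¹ c ^ (N g)⁻¹`. -/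
def separation (h : GroupoidHom w) (N : Grp w → FreeGroup X) (g : Grp w) (c : C w) : C w :=
  (h.value g (delta w c))⁻¹ * act w (N g)⁻¹ c

/-! ### The separation homomorphism as a retraction of `C(R)` onto `π₂`. -/

section Separation

variable {h : GroupoidHom w} {N : Grp w → FreeGroup X}

/-- Since `δ₂(c)` is a loop at `g`, both factors have boundary `N(g) δ₂(c) N(g)⁻¹`, up to the
inverse on the first. -/
lemma delta_separation
    (hN : ∀ g u, delta w (h.value g u) = N g * u * (N (g * theta w u))⁻¹)
    (g : Grp w) (c : C w) : delta w (separation h N g c) = 1 := by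
  rw [separation, map_mul, map_inv, hN, theta_delta, mul_one, delta_act]
  group

/-- The morphism `h` is multiplicative on loops at `g`. The separation of `c` then appears between
the factors belonging to `d`, and being central it can be moved out. -/
lemma separation_mul
    (hN : ∀ g u, delta w (h.value g u) = N g * u * (N (g * theta w u))⁻¹)
    (g : Grp w) (c d : C w) :
    separation h N g (c * d) = separation h N g c * separation h N g d := by
  have e : separation h N g (c * d) =
      (h.value g (delta w d))⁻¹ * separation h N g c * act w (N g)⁻¹ d := by
    simp only [separation, map_mul, GroupoidHom.value_mul, theta_delta, mul_one, mul_inv_rev,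
      mul_assoc]
  rw [e, ← mul_comm_of_delta_eq_one (delta_separation hN g c), mul_assoc]
  rfl

/-- The boundary of `(ρ, u)` at the identity runs along `u⁻¹`, around the relator at `θ(u)⁻¹`, and
back. With `a = h[1, u⁻¹]` this conjugates the separation element at `θ(u)⁻¹` by `a`, which has no
effect on a central element. -/
lemma separation_gen
    (hN : ∀ g u, delta w (h.value g u) = N g * u * (N (g * theta w u))⁻¹)
    (hN1 : N 1 = 1) (ρ : ℛ) (u : FreeGroup X) :
    separation h N 1 (gen w ρ u) = separation h N (theta w u)⁻¹ (gen w ρ 1) := by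
  have hρ : theta w (w ρ) = 1 := by simpa using theta_delta w (gen w ρ 1)
  have ha := hN 1 u⁻¹
  rw [hN1, one_mul, one_mul, map_inv] at ha
  have e1 : h.value 1 (delta w (gen w ρ u)) =
      h.value 1 u⁻¹ * h.value (theta w u)⁻¹ (w ρ) * (h.value 1 u⁻¹)⁻¹ := by
    rw [delta_gen, GroupoidHom.value_mul, GroupoidHom.value_mul, GroupoidHom.value_inv h 1 u]
    simp [hρ]
  -- The Peiffer rule for `a`, whose boundary is `u⁻¹ N(θ(u)⁻¹)⁻¹`: acting with it on `(ρ, u)`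
  -- cancels `u`.
  have e2 : act w (N (theta w u)⁻¹)⁻¹ (gen w ρ 1) =
      (h.value 1 u⁻¹)⁻¹ * gen w ρ u * h.value 1 u⁻¹ := by
    rw [peiffer_rule, ha, act_gen, act_gen]
    simp
  have e3 : separation h N 1 (gen w ρ u) =
      h.value 1 u⁻¹ * separation h N (theta w u)⁻¹ (gen w ρ 1) * (h.value 1 u⁻¹)⁻¹ := by
    rw [separation, separation, e1, e2, hN1, inv_one, act_one, delta_gen]
    group
  rw [e3, ← mul_comm_of_delta_eq_one (delta_separation hN _ _), mul_inv_cancel_right]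

lemma generatesPi2_separation
    (hN : ∀ g u, delta w (h.value g u) = N g * u * (N (g * theta w u))⁻¹)
    (hN1 : N 1 = 1) :
    GeneratesPi2 w {c | ∃ g ρ, c = separation h N g (gen w ρ 1)} := by
  refine ⟨?_, ?_⟩
  · rintro _ ⟨g, ρ, rfl⟩
    exact delta_separation hN g _
  let σ : C w →* Ident w := MonoidHom.mk' (fun c => ⟨separation h N 1 c, delta_separation hN 1 c⟩)
    fun c d => Subtype.ext (separation_mul hN 1 c d)
  let M := Submodule.span (MonoidAlgebra ℤ (Grp w))
    {a : Pi2 w | a.val ∈ {c | ∃ g ρ, c = separation h N g (gen w ρ 1)}}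
  -- It suffices that `σ` maps the generators of `C(R)` into the span; only the additive structure
  -- of the span is used.
  let K : Subgroup (C w) :=
    { carrier := {c | Additive.ofMul (σ c) ∈ M}
      one_mem' := by
        change Additive.ofMul (σ 1) ∈ M
        rw [map_one, ofMul_one]
        exact M.zero_mem
      mul_mem' := by
        intro a b ha hb
        change Additive.ofMul (σ (a * b)) ∈ M
        rw [map_mul, ofMul_mul]
        exact M.add_mem ha hb
      inv_mem' := by
        intro a ha
        change Additive.ofMul (σ a⁻¹) ∈ M
        rw [map_inv, ofMul_inv]
        exact M.neg_mem ha }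
  have hle : Subgroup.closure (Set.range (PresentedGroup.of : ℛ × FreeGroup X → C w)) ≤ K := by
    rw [Subgroup.closure_le]
    rintro _ ⟨⟨ρ, u⟩, rfl⟩
    exact Submodule.subset_span ⟨_, _, separation_gen hN hN1 ρ u⟩
  rw [PresentedGroup.closure_range_of] at hle
  rw [eq_top_iff]
  intro a _
  -- On an identity the loop `δ₂(a)` is trivial and `N(1) = 1`, so `σ` restricts to the identity map
  -- of `π₂`.
  have ha : Additive.ofMul (σ a.val) = a := by
    apply Subtype.ext
    change separation h N 1 a.val = a.val
    have hd : delta w a.val = 1 := MonoidHom.mem_ker.1 a.toMul.2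
    rw [separation, hd, GroupoidHom.value_one, hN1, inv_one, inv_one, act_one, one_mul]
  rw [← ha]
  exact hle trivial

end Separation

end Groupoid

/-! ### Normal forms and the contracting homotopy of a complete system. -/

section Homotopy

variable {X ℛ : Type*} {w : ℛ → Word X} {S : Set (Word X × Word X)}
  {N : Grp (relators w) → Word X}

lemma val_surjective (w : ℛ → Word X) : Function.Surjective (val w) := by
  intro g
  obtain ⟨u, rfl⟩ := QuotientGroup.mk_surjective g
  induction u using Quot.inductionOn with
  | h u => exact ⟨u, rfl⟩

lemma IsNormalForm.eq_of_irred (hN : IsNormalForm w S N) {u : Word X} (hu : Irred S u) :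
    N (val w u) = u :=
  (hu.eq_of_reflTransGen (hN.reduces u)).symm

variable {R2 : List (Rule X ℛ)}

lemma IsCompleteEIRS.normalForm_one (h : IsCompleteEIRS w R2) (hN : IsNormalForm w (R1 R2) N) :
    N 1 = [] := by
  rw [← val_nil w]
  exact hN.eq_of_irred h.complete.irred_nil

lemma sep_eq_separation (h1 : GroupoidHom (relators w)) (g : Grp (relators w)) (ρ : ℛ) :
    sep w N h1 g ρ = separation h1 (fun g => FreeGroup.mk (N g)) g (gen (relators w) ρ 1) := by
  rw [sep, GroupoidHom.p2_map]
  rfl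

variable [DecidableEq X]

lemma reduceWord2_eq_normalForm (hR : Terminates R2) (hE : IsEIRS w R2)
    (hN : IsNormalForm w (R1 R2) N) (z : Word X) : (reduceWord2 R2 z).2 = N (val w z) := by
  rw [← hN.eq_of_irred (hR.reduceWord2_irred z), (hR.reduceWord2_records hE z).val_eq]

lemma IsCompleteEIRS.existsUnique_normalForm (h : IsCompleteEIRS w R2) :
    ∃! N, IsNormalForm w (R1 R2) N := by
  have hT : Terminates R2 := h.complete.1
  choose f hf using val_surjective w
  have hv : ∀ z, val w (reduceWord2 R2 z).2 = val w z := fun z =>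
    ((hT.reduceWord2_records h.eirs z).val_eq).symm
  have hN : IsNormalForm w (R1 R2) fun g => (reduceWord2 R2 (f g)).2 := by
    refine ⟨fun g => by rw [hv, hf], fun g => hT.reduceWord2_irred _, fun u => ?_⟩
    have e : (reduceWord2 R2 u).2 = (reduceWord2 R2 (f (val w u))).2 := by
      refine h.complete.eq_of_eqvGen (hT.reduceWord2_irred _) (hT.reduceWord2_irred _) ?_
      rw [h.system, hv, hv, hf]
    rw [← e]
    exact hT.reduceWord2_reduces u
  refine ⟨_, hN, fun N hN' => funext fun g => ?_⟩
  rw [← hN.eq_of_irred (hN'.irred g), hN'.val_eq]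

/-- The word being reduced represents the identity, so its normal form is empty and the boundary of
the record is the whole word. -/
lemma IsCompleteEIRS.delta_edgeInfo (h : IsCompleteEIRS w R2) (hN : IsNormalForm w (R1 R2) N)
    (g : Grp (relators w)) (x : X) :
    delta (relators w) (cls w (edgeInfo w R2 N g x)) = FreeGroup.mk (N g) * FreeGroup.of x *
      (FreeGroup.mk (N (g * theta (relators w) (FreeGroup.of x))))⁻¹ := by
  have hT : Terminates R2 := h.complete.1
  have h1 := hT.reduceWord2_records h.eirs (N g ++ [(x, true)] ++
    FreeGroup.invRev (N (g * val w [(x, true)])))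
  rw [Records, reduceWord2_eq_normalForm hT h.eirs hN] at h1
  have h2 : val w (N g ++ [(x, true)] ++ FreeGroup.invRev (N (g * val w [(x, true)]))) = 1 := by
    rw [val_append, val_append, val_invRev, hN.val_eq, hN.val_eq, mul_inv_cancel]
  rw [h2, h.normalForm_one hN, ← FreeGroup.one_eq_mk, mul_one] at h1
  rw [edgeInfo, ← h1, ← FreeGroup.mul_mk, ← FreeGroup.mul_mk, mk_invRev]
  rfl

lemma isDeterminedBy_iff {h1 : GroupoidHom (relators w)} : IsDeterminedBy w R2 N h1 ↔
    ∀ g x, h1.value g (FreeGroup.of x) = cls w (edgeInfo w R2 N g x) := by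
  refine forall_congr' fun g => forall_congr' fun x => ?_
  rw [CTilde.ext_iff]
  rfl

lemma IsCompleteEIRS.delta_value (h : IsCompleteEIRS w R2) (hN : IsNormalForm w (R1 R2) N)
    {h1 : GroupoidHom (relators w)} (hh : IsDeterminedBy w R2 N h1) (g : Grp (relators w))
    (u : FreeGroup X) : delta (relators w) (h1.value g u) = FreeGroup.mk (N g) * u *
      (FreeGroup.mk (N (g * theta (relators w) u)))⁻¹ :=
  GroupoidHom.delta_value (N := fun g => FreeGroup.mk (N g))
    (fun g x => by rw [isDeterminedBy_iff.1 hh, h.delta_edgeInfo hN]) g u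

lemma IsCompleteEIRS.generatesPi2 (h : IsCompleteEIRS w R2) (hN : IsNormalForm w (R1 R2) N)
    {h1 : GroupoidHom (relators w)} (hh : IsDeterminedBy w R2 N h1) :
    GeneratesPi2 (relators w) {c | ∃ g ρ, c = sep w N h1 g ρ} := by
  simp only [sep_eq_separation]
  refine generatesPi2_separation (h.delta_value hN hh) ?_
  rw [h.normalForm_one hN, FreeGroup.one_eq_mk]

lemma IsCompleteEIRS.isContractingHomotopy (h : IsCompleteEIRS w R2)
    (hN : IsNormalForm w (R1 R2) N) {h1 : GroupoidHom (relators w)}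
    (hh : IsDeterminedBy w R2 N h1) :
    IsContractingHomotopy (relators w) (h0 w N hN.val_eq) h1 := by
  refine ⟨Subtype.ext ?_, ?_⟩
  · change (FreeGroup.mk (N 1))⁻¹ = 1
    rw [h.normalForm_one hN, ← FreeGroup.one_eq_mk, inv_one]
  · intro g k f
    induction f using Cayley.induction with
    | h g u => ?_
    refine Subtype.ext ?_
    change delta (relators w) (h1.value g u) = ((FreeGroup.mk (N g))⁻¹)⁻¹ * (u *
      (FreeGroup.mk (N (g * theta (relators w) u)))⁻¹)
    rw [h.delta_value hN hh, inv_inv, mul_assoc]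

lemma exists_isDeterminedBy (w : ℛ → Word X) (R2 : List (Rule X ℛ))
    (N : Grp (relators w) → Word X) : ∃ h1, IsDeterminedBy w R2 N h1 ∧
      ∀ h1', IsDeterminedBy w R2 N h1' → h1' = h1 := by
  have h : IsDeterminedBy w R2 N
      (.ofEdges (relators w) fun g x => cls w (edgeInfo w R2 N g x)) :=
    isDeterminedBy_iff.2 fun g x => GroupoidHom.ofEdges_value _ g x
  refine ⟨_, h, fun h1' hh => GroupoidHom.ext_value fun g x => ?_⟩
  rw [isDeterminedBy_iff.1 hh, isDeterminedBy_iff.1 h]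

end Homotopy

end IdRel

namespace IdRel

open Relation

/-! ### Bounded versions of all constructions, and enumeration of irreducible words. -/

section Fuel

variable {X ℛ : Type*} [DecidableEq X]

/-- All critical pairs of rules of `R`. -/
def allPairs (R : List (Rule X ℛ)) : List ((YSeq X ℛ × Word X) × (YSeq X ℛ × Word X)) :=
  R.flatMap fun p => R.flatMap fun q => criticalPairs p q

/-- Reduce a word by `k` passes, keeping the information recorded before. -/
def reduceState (R : List (Rule X ℛ)) (k : ℕ) (s : YSeq X ℛ × Word X) : YSeq X ℛ × Word X :=
  (s.1 ++ (reduceFuel R k s.2).1, (reduceFuel R k s.2).2)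

open Classical in
/-- The rule, if any, which resolves a reduced critical pair. -/
noncomputable def orient (gt : Word X → Word X → Prop)
    (t : (YSeq X ℛ × Word X) × (YSeq X ℛ × Word X)) : List (Rule X ℛ) :=
  if gt t.1.2 t.2.2 then [(t.1.2, t.1.1.inverse ++ t.2.1, t.2.2)]
  else if gt t.2.2 t.1.2 then [(t.2.2, t.2.1.inverse ++ t.1.1, t.1.2)]
  else []

/-- The critical pairs of `R`, reduced by `k` passes. -/
def reducedPairs (R : List (Rule X ℛ)) (k : ℕ) :
    List ((YSeq X ℛ × Word X) × (YSeq X ℛ × Word X)) :=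
  (allPairs R).map fun t => (reduceState R k t.1, reduceState R k t.2)

/-- The rules which a pass of the completion procedure adds, computed with `k` reduction passes. -/
noncomputable def newRulesFuel (gt : Word X → Word X → Prop) (R : List (Rule X ℛ)) (k : ℕ) :
    List (Rule X ℛ) :=
  (reducedPairs R k).flatMap (orient gt)

/-- `k` passes suffice to reduce all words in a list. -/
def enough (R : List (Rule X ℛ)) (k : ℕ) (l : List (Word X)) : Bool :=
  l.all fun z => (redexes R (reduceFuel R k z).2).isEmpty

/-- The words which occur in critical pairs. -/
def pairWords (R : List (Rule X ℛ)) : List (Word X) :=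
  (allPairs R).flatMap fun t => [t.1.2, t.2.2]

/-- The irreducible words of length `i` in the letters `L`. -/
def level (L : List (X × Bool)) (R : List (Rule X ℛ)) (i : ℕ) : List (Word X) :=
  i.rec [[]] fun _ E => E.flatMap fun z =>
    (L.map fun y => z ++ [y]).filter fun z => (redexes R z).isEmpty

/-- The irreducible words of length less than `i`. -/
def levels (L : List (X × Bool)) (R : List (Rule X ℛ)) (i : ℕ) : List (Word X) :=
  (List.range i).flatMap (level L R)

/-- The word `z x N(z x)⁻¹`. -/
def edgeWord (R : List (Rule X ℛ)) (k : ℕ) (z : Word X) (x : X) : Word X :=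
  z ++ [(x, true)] ++ FreeGroup.invRev (reduceFuel R k (z ++ [(x, true)])).2

/-- The information recorded while `z x N(z x)⁻¹` is reduced. -/
def edgeFuel (R : List (Rule X ℛ)) (k : ℕ) (z : Word X) (x : X) : YSeq X ℛ :=
  (reduceFuel R k (edgeWord R k z x)).1

/-- Follow one edge of the Cayley graph. -/
def traverse (R : List (Rule X ℛ)) (k : ℕ) (s : YSeq X ℛ × Word X) (y : X × Bool) :
    YSeq X ℛ × Word X :=
  (s.1 ++ bif y.2 then edgeFuel R k s.2 y.1
    else (edgeFuel R k (reduceFuel R k (s.2 ++ [y])).2 y.1).inverse,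
    (reduceFuel R k (s.2 ++ [y])).2)

/-- The separation element at `z` of a relator. -/
def sepFuel (R : List (Rule X ℛ)) (k : ℕ) (z : Word X) (p : ℛ × Word X) : YSeq X ℛ :=
  (p.2.foldl (traverse R k) ([], z)).1.inverse ++ [((p.1, FreeGroup.invRev z), true)]

/-- The words which are reduced when edges from the words in `E` are followed. -/
def edgeWords (L : List (X × Bool)) (R : List (Rule X ℛ)) (E : List (Word X)) (k : ℕ) :
    List (Word X) :=
  E.flatMap fun z => L.flatMap fun y => [z ++ [y], edgeWord R k z y.1]

variable {R : List (Rule X ℛ)}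

lemma enough_iff {k : ℕ} {l : List (Word X)} :
    enough R k l = true ↔ ∀ z ∈ l, redexes R (reduceFuel R k z).2 = [] := by
  simp [enough]

lemma reduceFuel_eq_of_enough {k : ℕ} {l : List (Word X)} (h : enough R k l = true) {z : Word X}
    (hz : z ∈ l) : reduceFuel R k z = reduceWord2 R z :=
  (reduceWord2_eq (enough_iff.1 h z hz)).symm

lemma Terminates.exists_enough (hR : Terminates R) (l : List (Word X)) :
    ∃ K, ∀ k ≥ K, enough R k l = true := by
  choose f hf using hR.exists_fuel
  obtain ⟨K, hK⟩ := ((List.finite_toSet l).image f).bddAbove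
  refine ⟨K, fun k hk => enough_iff.2 fun z hz => ?_⟩
  rw [reduceFuel_stable (hf z) ((hK ⟨z, hz, rfl⟩).trans hk)]
  exact hf z

lemma newRulesFuel_eq {gt : Word X → Word X → Prop} {k : ℕ}
    (h : enough R k (pairWords R) = true) : newRulesFuel gt R k = newRules gt R := by
  have e : newRules gt R = (allPairs R).flatMap (resolve gt R) := by
    simp [newRules, allPairs, List.flatMap_assoc]
  rw [e, newRulesFuel, reducedPairs, List.flatMap_map]
  refine List.flatMap_congr fun t ht => ?_
  have h1 := reduceFuel_eq_of_enough h (z := t.1.2)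
    (List.mem_flatMap.2 ⟨t, ht, by simp⟩)
  have h2 := reduceFuel_eq_of_enough h (z := t.2.2)
    (List.mem_flatMap.2 ⟨t, ht, by simp⟩)
  unfold reduceState orient resolve
  rw [h1, h2]

/-- Prefixes of irreducible words are irreducible, so each level consists of one-letter extensions
of the previous one. -/
lemma mem_level {L : List (X × Bool)} (hL : ∀ y, y ∈ L) (h0 : Irred (R1 R) []) {i : ℕ}
    {z : Word X} : z ∈ level L R i ↔ z.length = i ∧ Irred (R1 R) z := by
  induction i generalizing z with
  | zero =>
    change z ∈ [[]] ↔ _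
    rw [List.mem_singleton, List.length_eq_zero_iff]
    exact ⟨fun h => ⟨h, h ▸ h0⟩, fun h => h.1⟩
  | succ i ih =>
    change z ∈ List.flatMap _ (level L R i) ↔ _
    simp only [List.mem_flatMap, List.mem_filter, List.mem_map, List.isEmpty_iff,
      redexes_eq_nil_iff]
    constructor
    · rintro ⟨z', hz', ⟨y, _, rfl⟩, h⟩
      exact ⟨by simp [(ih.1 hz').1], h⟩
    · rintro ⟨hz, h⟩
      rcases List.eq_nil_or_concat z with rfl | ⟨z', y, rfl⟩
      · simp at hz
      · rw [List.concat_eq_append] at *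
        refine ⟨z', ih.2 ⟨by simpa using hz, ?_⟩, ⟨y, hL y, rfl⟩, h⟩
        exact Irred.of_append (p := []) (q := [y]) h

lemma level_nodup {L : List (X × Bool)} (hL : L.Nodup) (i : ℕ) : (level L R i).Nodup := by
  induction i with
  | zero => exact List.nodup_singleton _
  | succ i ih =>
    change (List.flatMap _ (level L R i)).Nodup
    rw [List.nodup_flatMap]
    refine ⟨fun z _ => List.Nodup.filter _ (hL.map fun a b h => by simpa using h), ?_⟩
    refine ih.imp fun {a b} hab => ?_
    intro z h1 h2
    simp only [List.mem_filter, List.mem_map] at h1 h2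
    obtain ⟨⟨y, _, rfl⟩, _⟩ := h1
    obtain ⟨⟨y', _, h⟩, _⟩ := h2
    exact hab (List.append_inj_left' h rfl).symm

/-- Once level `i` is empty the enumeration is exhaustive: a longer irreducible word would have its
prefix of length `i` in that level. -/
lemma mem_levels {L : List (X × Bool)} (hL : ∀ y, y ∈ L) (h0 : Irred (R1 R) []) {i : ℕ}
    (hi : level L R i = []) {z : Word X} : z ∈ levels L R i ↔ Irred (R1 R) z := by
  simp only [levels, List.mem_flatMap, List.mem_range, mem_level hL h0]
  refine ⟨fun ⟨_, _, _, h⟩ => h, fun h => ⟨_, ?_, rfl, h⟩⟩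
  by_contra! hlt
  have h1 : z.take i ∈ level L R i := by
    refine (mem_level hL h0).2 ⟨by simpa using hlt, ?_⟩
    refine Irred.of_append (p := []) (q := z.drop i) ?_
    simpa using h
  simp [hi] at h1

lemma levels_nodup {L : List (X × Bool)} (hL : ∀ y, y ∈ L) (hL' : L.Nodup)
    (h0 : Irred (R1 R) []) (i : ℕ) : (levels L R i).Nodup := by
  rw [levels, List.nodup_flatMap]
  refine ⟨fun i _ => level_nodup hL' i, List.nodup_range.imp fun {a b} hab => ?_⟩
  intro z h1 h2
  exact hab (((mem_level hL h0).1 h1).1.symm.trans ((mem_level hL h0).1 h2).1)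

lemma exists_level_eq_nil {L : List (X × Bool)} (hL : ∀ y, y ∈ L) (h0 : Irred (R1 R) [])
    (hfin : {z | Irred (R1 R) z}.Finite) : ∃ i, level L R i = [] := by
  obtain ⟨K, hK⟩ := (hfin.image List.length).bddAbove
  refine ⟨K + 1, List.eq_nil_iff_forall_not_mem.2 fun z hz => ?_⟩
  obtain ⟨h1, h2⟩ := (mem_level hL h0).1 hz
  have := hK ⟨z, h2, rfl⟩
  omega

/-- The list to be reduced itself depends on `k`, through the inner normal form in `edgeWord`. From
`K1` on it is constant, and then `K2` bounds its reduction. -/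
lemma Terminates.exists_enough_edgeWords (hR : Terminates R) (L : List (X × Bool))
    (E : List (Word X)) : ∃ k, enough R k (edgeWords L R E k) = true := by
  obtain ⟨K1, h1⟩ := hR.exists_enough (E.flatMap fun z => L.flatMap fun y =>
    [z ++ [y], z ++ [(y.1, true)]])
  obtain ⟨K2, h2⟩ := hR.exists_enough (edgeWords L R E K1)
  refine ⟨max K1 K2, ?_⟩
  have e : edgeWords L R E (max K1 K2) = edgeWords L R E K1 := by
    refine List.flatMap_congr fun z hz => List.flatMap_congr fun y hy => ?_
    have hmem : z ++ [(y.1, true)] ∈ E.flatMap fun z => L.flatMap fun y =>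
        [z ++ [y], z ++ [(y.1, true)]] :=
      List.mem_flatMap.2 ⟨z, hz, List.mem_flatMap.2 ⟨y, hy, by simp⟩⟩
    rw [edgeWord, edgeWord, reduceFuel_eq_of_enough (h1 _ (le_max_left _ _)) hmem,
      reduceFuel_eq_of_enough (h1 _ le_rfl) hmem]
  rw [e]
  exact h2 _ (le_max_right _ _)

variable {w : ℛ → Word X} {N : Grp (relators w) → Word X} {h1 : GroupoidHom (relators w)}
  {L : List (X × Bool)} {E : List (Word X)} {k : ℕ}

lemma IsCompleteEIRS.reduceFuel_normalForm (h : IsCompleteEIRS w R)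
    (hN : IsNormalForm w (R1 R) N) (hL : ∀ y, y ∈ L) (hE : ∀ g, N g ∈ E)
    (hk : enough R k (edgeWords L R E k) = true) (g : Grp (relators w)) (y : X × Bool) :
    (reduceFuel R k (N g ++ [y])).2 = N (g * val w [y]) := by
  rw [reduceFuel_eq_of_enough hk (List.mem_flatMap.2 ⟨_, hE g, List.mem_flatMap.2
    ⟨y, hL y, by simp⟩⟩), reduceWord2_eq_normalForm h.complete.1 h.eirs hN, val_append, hN.val_eq]

lemma IsCompleteEIRS.edgeFuel_eq (h : IsCompleteEIRS w R) (hN : IsNormalForm w (R1 R) N)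
    (hL : ∀ y, y ∈ L) (hE : ∀ g, N g ∈ E) (hk : enough R k (edgeWords L R E k) = true)
    (g : Grp (relators w)) (x : X) : edgeFuel R k (N g) x = edgeInfo w R N g x := by
  rw [edgeFuel, reduceFuel_eq_of_enough hk (List.mem_flatMap.2 ⟨_, hE g, List.mem_flatMap.2
    ⟨(x, true), hL _, by simp⟩⟩), edgeWord, h.reduceFuel_normalForm hN hL hE hk, edgeInfo]

lemma IsCompleteEIRS.cls_traverse (h : IsCompleteEIRS w R) (hN : IsNormalForm w (R1 R) N)
    (hh : IsDeterminedBy w R N h1) (hL : ∀ y, y ∈ L) (hE : ∀ g, N g ∈ E)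
    (hk : enough R k (edgeWords L R E k) = true) (g : Grp (relators w)) (c : YSeq X ℛ)
    (y : X × Bool) : ∃ d, traverse R k (c, N g) y = (d, N (g * val w [y])) ∧
      cls w d = cls w c * h1.value g (FreeGroup.mk [y]) := by
  refine ⟨_, Prod.ext rfl (h.reduceFuel_normalForm hN hL hE hk g y), ?_⟩
  rw [traverse, cls_append]
  congr 1
  rcases y with ⟨x, _ | _⟩
  -- A letter `x⁻¹` traverses backwards the edge that starts at the new vertex, so the information
  -- is taken there and inverted.
  · have e : FreeGroup.mk [(x, false)] = (FreeGroup.of x)⁻¹ := rfl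
    rw [cond_false, cls_inverse, h.reduceFuel_normalForm hN hL hE hk, h.edgeFuel_eq hN hL hE hk,
      e, GroupoidHom.value_inv, isDeterminedBy_iff.1 hh, val, e, map_inv]
  · have e : FreeGroup.mk [(x, true)] = FreeGroup.of x := rfl
    rw [cond_true, h.edgeFuel_eq hN hL hE hk, e, isDeterminedBy_iff.1 hh]

lemma IsCompleteEIRS.cls_foldl_traverse (h : IsCompleteEIRS w R) (hN : IsNormalForm w (R1 R) N)
    (hh : IsDeterminedBy w R N h1) (hL : ∀ y, y ∈ L) (hE : ∀ g, N g ∈ E)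
    (hk : enough R k (edgeWords L R E k) = true) (u : Word X) (g : Grp (relators w))
    (c : YSeq X ℛ) : cls w (u.foldl (traverse R k) (c, N g)).1 =
      cls w c * h1.value g (FreeGroup.mk u) := by
  induction u generalizing g c with
  | nil => simp [← FreeGroup.one_eq_mk]
  | cons y u ih =>
    obtain ⟨d, hd, hc⟩ := h.cls_traverse hN hh hL hE hk g c y
    have e : FreeGroup.mk (y :: u) = FreeGroup.mk [y] * FreeGroup.mk u := rfl
    rw [List.foldl_cons, hd, ih, hc, e, GroupoidHom.value_mul, mul_assoc]
    rfl

lemma IsCompleteEIRS.cls_sepFuel (h : IsCompleteEIRS w R) (hN : IsNormalForm w (R1 R) N)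
    (hh : IsDeterminedBy w R N h1) (hL : ∀ y, y ∈ L) (hE : ∀ g, N g ∈ E)
    (hk : enough R k (edgeWords L R E k) = true) (g : Grp (relators w)) (ρ : ℛ) :
    cls w (sepFuel R k (N g) (ρ, w ρ)) = sep w N h1 g ρ := by
  rw [sepFuel, cls_append, cls_inverse, h.cls_foldl_traverse hN hh hL hE hk, sep_eq_separation,
    separation, delta_gen, act_gen]
  simp [cls, relators]

end Fuel

/-! ### Compatibility of the constructions with the encoding over `ℕ`. -/

section Raw

variable {n m : ℕ}

/-- Redexes and overlaps are found by comparing words; injectivity ensures that these tests have the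
same outcome on encoded data. -/
lemma rawWord_injective : Function.Injective (rawWord (n := n)) :=
  List.map_injective_iff.2 fun a b h => by
    simp only [Prod.mk.injEq] at h
    exact Prod.ext (Fin.ext h.1) h.2

@[simp] lemma rawWord_append (u v : Word (Fin n)) :
    rawWord (u ++ v) = rawWord u ++ rawWord v := List.map_append

@[simp] lemma length_rawWord (u : Word (Fin n)) : (rawWord u).length = u.length :=
  List.length_map _

@[simp] lemma take_rawWord (u : Word (Fin n)) (i : ℕ) :
    (rawWord u).take i = rawWord (u.take i) := List.map_take.symm

@[simp] lemma drop_rawWord (u : Word (Fin n)) (i : ℕ) :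
    (rawWord u).drop i = rawWord (u.drop i) := List.map_drop.symm

@[simp] lemma invRev_rawWord (u : Word (Fin n)) :
    FreeGroup.invRev (rawWord u) = rawWord (FreeGroup.invRev u) := by
  simp [rawWord, FreeGroup.invRev]

@[simp] lemma rawYSeq_append (a b : YSeq (Fin n) (Fin m)) :
    rawYSeq (a ++ b) = rawYSeq a ++ rawYSeq b := List.map_append

@[simp] lemma act_rawYSeq (a : YSeq (Fin n) (Fin m)) (u : Word (Fin n)) :
    (rawYSeq a).act (rawWord u) = rawYSeq (a.act u) := by
  simp [rawYSeq, YSeq.act]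

@[simp] lemma inverse_rawYSeq (a : YSeq (Fin n) (Fin m)) :
    (rawYSeq a).inverse = rawYSeq a.inverse := by
  simp [rawYSeq, YSeq.inverse]

/-- Forget the bounds in a pair of a `Y`-sequence and a word. -/
def rawState (s : YSeq (Fin n) (Fin m) × Word (Fin n)) : YSeq ℕ ℕ × Word ℕ :=
  (rawYSeq s.1, rawWord s.2)

/-- Forget the bounds in a critical pair. -/
def rawPair (t : (YSeq (Fin n) (Fin m) × Word (Fin n)) × (YSeq (Fin n) (Fin m) × Word (Fin n))) :
    (YSeq ℕ ℕ × Word ℕ) × (YSeq ℕ ℕ × Word ℕ) :=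
  (rawState t.1, rawState t.2)

/-- Forget the bound in a letter. -/
def rawLetter (y : Fin n × Bool) : ℕ × Bool := (y.1, y.2)

lemma rawWord_singleton (y : Fin n × Bool) : rawWord [y] = [rawLetter y] := rfl

lemma redexes_raw (R : List (Rule (Fin n) (Fin m))) (z : Word (Fin n)) :
    redexes (R.map rawRule) (rawWord z) = (redexes R z).map rawState := by
  rw [redexes, redexes, List.flatMap_map, List.map_flatMap]
  refine List.flatMap_congr fun p _ => ?_
  rw [List.map_filterMap, length_rawWord]
  refine List.filterMap_congr fun i _ => ?_
  simp only [rawRule, drop_rawWord, length_rawWord, take_rawWord, ← rawWord_append,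
    rawWord_injective.eq_iff, invRev_rawWord, act_rawYSeq]
  split_ifs <;> rfl

lemma onePass_raw (R : List (Rule (Fin n) (Fin m))) (s : YSeq (Fin n) (Fin m) × Word (Fin n)) :
    onePass (R.map rawRule) (rawState s) = rawState (onePass R s) := by
  have e := redexes_raw R s.2
  rcases h : redexes R s.2 with _ | ⟨t, ts⟩ <;> rw [h] at e <;>
    simp [onePass, h, rawState, e]

lemma reduceFuel_raw (R : List (Rule (Fin n) (Fin m))) (k : ℕ) (z : Word (Fin n)) :
    reduceFuel (R.map rawRule) k (rawWord z) = rawState (reduceFuel R k z) := by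
  induction k with
  | zero => rfl
  | succ k ih => rw [reduceFuel_succ, reduceFuel_succ, ih, onePass_raw]

lemma criticalPairs_raw (p q : Rule (Fin n) (Fin m)) :
    criticalPairs (rawRule p) (rawRule q) = (criticalPairs p q).map rawPair := by
  rw [criticalPairs, criticalPairs, List.map_append]
  congr 1
  · have := redexes_raw [p] q.1
    rw [List.map_singleton] at this
    simp only [rawRule] at this ⊢
    rw [this, List.map_map, List.map_map]
    rfl
  · rw [List.map_filterMap]
    simp only [rawRule, length_rawWord]
    refine List.filterMap_congr fun i _ => ?_
    simp only [drop_rawWord, take_rawWord, ← rawWord_append,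
      rawWord_injective.eq_iff, invRev_rawWord, act_rawYSeq]
    split_ifs <;> rfl

lemma allPairs_raw (R : List (Rule (Fin n) (Fin m))) :
    allPairs (R.map rawRule) = (allPairs R).map rawPair := by
  simp only [allPairs, List.flatMap_map, List.map_flatMap, criticalPairs_raw]

lemma pairWords_raw (R : List (Rule (Fin n) (Fin m))) :
    pairWords (R.map rawRule) = (pairWords R).map rawWord := by
  simp only [pairWords, allPairs_raw, List.flatMap_map, List.map_flatMap]
  rfl

lemma enough_raw (R : List (Rule (Fin n) (Fin m))) (k : ℕ) (l : List (Word (Fin n))) :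
    enough (R.map rawRule) k (l.map rawWord) = enough R k l := by
  simp only [enough, List.all_map]
  congr 1
  ext z
  simp only [Function.comp_apply, reduceFuel_raw, rawState, redexes_raw, List.isEmpty_map]

lemma orient_raw (gt : Word ℕ → Word ℕ → Prop)
    (t : (YSeq (Fin n) (Fin m) × Word (Fin n)) × (YSeq (Fin n) (Fin m) × Word (Fin n))) :
    orient gt (rawPair t) =
      (orient (fun u v => gt (rawWord u) (rawWord v)) t).map rawRule := by
  unfold orient
  by_cases h1 : gt (rawWord t.1.2) (rawWord t.2.2)
  · rw [if_pos (c := gt (rawWord t.1.2) (rawWord t.2.2)) h1]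
    refine (if_pos h1).trans ?_
    simp [rawPair, rawState, rawRule]
  rw [if_neg (c := gt (rawWord t.1.2) (rawWord t.2.2)) h1]
  refine (if_neg h1).trans ?_
  by_cases h2 : gt (rawWord t.2.2) (rawWord t.1.2)
  · rw [if_pos (c := gt (rawWord t.2.2) (rawWord t.1.2)) h2]
    refine (if_pos h2).trans ?_
    simp [rawPair, rawState, rawRule]
  · rw [if_neg (c := gt (rawWord t.2.2) (rawWord t.1.2)) h2]
    exact if_neg h2

lemma reducedPairs_raw (R : List (Rule (Fin n) (Fin m))) (k : ℕ) :
    reducedPairs (R.map rawRule) k = (reducedPairs R k).map rawPair := by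
  simp only [reducedPairs, allPairs_raw, List.map_map]
  refine List.map_congr_left fun t _ => ?_
  simp [rawPair, rawState, reduceState, reduceFuel_raw]

lemma newRulesFuel_raw (gt : Word ℕ → Word ℕ → Prop) (R : List (Rule (Fin n) (Fin m))) (k : ℕ) :
    newRulesFuel gt (R.map rawRule) k =
      (newRulesFuel (fun u v => gt (rawWord u) (rawWord v)) R k).map rawRule := by
  simp only [newRulesFuel, reducedPairs_raw, List.flatMap_map, List.map_flatMap, orient_raw]

lemma level_raw (L : List (Fin n × Bool)) (R : List (Rule (Fin n) (Fin m))) (i : ℕ) :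
    level (L.map rawLetter) (R.map rawRule) i = (level L R i).map rawWord := by
  induction i with
  | zero => rfl
  | succ i ih =>
    change List.flatMap _ (level _ _ i) = List.map rawWord (List.flatMap _ (level L R i))
    rw [ih, List.flatMap_map, List.map_flatMap]
    refine List.flatMap_congr fun z _ => ?_
    have e : (L.map rawLetter).map (fun y => rawWord z ++ [y]) =
        (L.map fun y => z ++ [y]).map rawWord := by
      simp only [List.map_map]
      refine List.map_congr_left fun y _ => ?_
      simp [rawWord_singleton]
    rw [e, List.filter_map]
    congr 1
    refine List.filter_congr fun z _ => ?_
    simp [redexes_raw]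

lemma levels_raw (L : List (Fin n × Bool)) (R : List (Rule (Fin n) (Fin m))) (i : ℕ) :
    levels (L.map rawLetter) (R.map rawRule) i = (levels L R i).map rawWord := by
  simp only [levels, List.map_flatMap]
  exact List.flatMap_congr fun i _ => level_raw L R i

lemma edgeWord_raw (R : List (Rule (Fin n) (Fin m))) (k : ℕ) (z : Word (Fin n)) (x : Fin n) :
    edgeWord (R.map rawRule) k (rawWord z) x = rawWord (edgeWord R k z x) := by
  have e : [((x : ℕ), true)] = rawWord [(x, true)] := rfl
  simp only [edgeWord, e, ← rawWord_append, reduceFuel_raw, rawState, invRev_rawWord]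

lemma edgeFuel_raw (R : List (Rule (Fin n) (Fin m))) (k : ℕ) (z : Word (Fin n)) (x : Fin n) :
    edgeFuel (R.map rawRule) k (rawWord z) x = rawYSeq (edgeFuel R k z x) := by
  simp only [edgeFuel, edgeWord_raw, reduceFuel_raw, rawState]

lemma traverse_raw (R : List (Rule (Fin n) (Fin m))) (k : ℕ)
    (s : YSeq (Fin n) (Fin m) × Word (Fin n)) (y : Fin n × Bool) :
    traverse (R.map rawRule) k (rawState s) (rawLetter y) = rawState (traverse R k s y) := by
  rcases y with ⟨x, b⟩
  have e : [rawLetter (x, b)] = rawWord [(x, b)] := rfl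
  simp only [traverse, e, rawState, ← rawWord_append, reduceFuel_raw]
  cases b <;> simp [rawLetter, edgeFuel_raw]

lemma sepFuel_raw (R : List (Rule (Fin n) (Fin m))) (k : ℕ) (z : Word (Fin n)) (ρ : Fin m)
    (u : Word (Fin n)) :
    sepFuel (R.map rawRule) k (rawWord z) (ρ, rawWord u) = rawYSeq (sepFuel R k z (ρ, u)) := by
  have key : ∀ s : YSeq (Fin n) (Fin m) × Word (Fin n),
      (rawWord u).foldl (traverse (R.map rawRule) k) (rawState s) =
        rawState (u.foldl (traverse R k) s) := by
    induction u with
    | nil => exact fun _ => rfl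
    | cons y u ih =>
      intro s
      have := ih (traverse R k s y)
      rw [← traverse_raw] at this
      exact this
  have h := key ([], z)
  rw [sepFuel, sepFuel, rawYSeq_append, ← inverse_rawYSeq]
  have h' : (rawWord u).foldl (traverse (R.map rawRule) k) ([], rawWord z) =
    rawState (u.foldl (traverse R k) ([], z)) := h
  simp only [h', invRev_rawWord]
  rfl

lemma edgeWords_raw (L : List (Fin n × Bool)) (R : List (Rule (Fin n) (Fin m)))
    (E : List (Word (Fin n))) (k : ℕ) :
    edgeWords (L.map rawLetter) (R.map rawRule) (E.map rawWord) k =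
      (edgeWords L R E k).map rawWord := by
  simp only [edgeWords, List.map_flatMap, List.flatMap_map]
  refine List.flatMap_congr fun z _ => List.flatMap_congr fun y _ => ?_
  rw [← rawWord_singleton, ← rawWord_append]
  simp only [rawLetter, edgeWord_raw]
  rfl

/-- The letters of the free group on `n` generators. -/
def rawLetters (n : ℕ) : List (ℕ × Bool) :=
  (List.range n).flatMap fun x => [(x, true), (x, false)]

/-- The letters of the free group on `n` generators. -/
def letters (n : ℕ) : List (Fin n × Bool) :=
  (List.finRange n).flatMap fun x => [(x, true), (x, false)]

lemma mem_letters (y : Fin n × Bool) : y ∈ letters n := by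
  rcases y with ⟨x, _ | _⟩ <;> simp [letters]

lemma letters_nodup (n : ℕ) : (letters n).Nodup := by
  rw [letters, List.nodup_flatMap]
  refine ⟨fun x _ => by simp, (List.nodup_finRange n).imp fun {a b} hab => ?_⟩
  intro y h1 h2
  simp only [List.mem_cons, List.not_mem_nil, or_false] at h1 h2
  rcases h1 with rfl | rfl <;> simp_all

lemma range_eq_finRange (n : ℕ) : List.range n = (List.finRange n).map Fin.val := by
  simp

lemma rawLetters_eq (n : ℕ) : rawLetters n = (letters n).map rawLetter := by
  rw [rawLetters, letters, range_eq_finRange, List.flatMap_map, List.map_flatMap]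
  rfl

/-- The relators, together with their labels. -/
def labelled (l : List (Word ℕ)) : List (ℕ × Word ℕ) :=
  (List.range l.length).map fun i => (i, l.getD i [])

lemma labelled_rawPres (w : Fin m → Word (Fin n)) :
    labelled (rawPres w).2 = (List.finRange m).map fun ρ : Fin m => ((ρ : ℕ), rawWord (w ρ)) := by
  simp only [labelled, rawPres, List.length_ofFn, range_eq_finRange, List.map_map]
  -- The index is below the length of the list, so the default `[]` of `getD` never occurs.
  refine List.map_congr_left fun ρ _ => ?_
  simp

/-- The initial system of a presentation. -/
def rawInitial (p : ℕ × List (Word ℕ)) : List (Rule ℕ ℕ) :=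
  (List.range p.1).flatMap (fun x =>
    [([(x, true), (x, false)], [], []), ([(x, false), (x, true)], [], [])]) ++
  ((labelled p.2).filter fun q => !q.2.isEmpty).map fun q => (q.2, [((q.1, []), true)], [])

lemma rawInitial_rawPres (w : Fin m → Word (Fin n)) :
    rawInitial (rawPres w) = (initial w).map rawRule := by
  rw [rawInitial, labelled_rawPres, initial, List.map_append]
  congr 1
  · rw [rawPres, range_eq_finRange, List.flatMap_map, List.map_flatMap]
    rfl
  · rw [List.filter_map, List.map_map, List.map_map]
    congr 1
    refine List.filter_congr fun ρ _ => ?_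
    simp [rawWord]

end Raw

end IdRel

namespace IdRel

open Primrec

/-! ### Primitive recursiveness of the bounded constructions. -/

section Primrec

lemma primrec_invRev : Primrec (FreeGroup.invRev : Word ℕ → Word ℕ) :=
  list_reverse.comp (list_map .id (pair (fst.comp snd) (Primrec.not.comp (snd.comp snd))).to₂)

lemma primrec_act : Primrec₂ (YSeq.act : YSeq ℕ ℕ → Word ℕ → YSeq ℕ ℕ) :=
  list_map fst (pair (pair (fst.comp (fst.comp snd))
    (list_append.comp (snd.comp (fst.comp snd)) (snd.comp fst))) (snd.comp snd)).to₂

lemma primrec_inverse : Primrec (YSeq.inverse : YSeq ℕ ℕ → YSeq ℕ ℕ) :=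
  list_reverse.comp (list_map .id (pair (fst.comp snd) (Primrec.not.comp (snd.comp snd))).to₂)

lemma primrec_redexes : Primrec₂ (redexes : List (Rule ℕ ℕ) → Word ℕ → _) := by
  refine list_flatMap fst (Primrec₂.mk ?_)
  refine listFilterMap (list_range.comp (succ.comp (list_length.comp (snd.comp fst))))
    (Primrec₂.mk ?_)
  have hz : Primrec fun q : ((List (Rule ℕ ℕ) × Word ℕ) × Rule ℕ ℕ) × ℕ => q.1.1.2 :=
    snd.comp (fst.comp fst)
  have hp : Primrec fun q : ((List (Rule ℕ ℕ) × Word ℕ) × Rule ℕ ℕ) × ℕ => q.1.2 :=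
    snd.comp fst
  have hd : Primrec fun q : ((List (Rule ℕ ℕ) × Word ℕ) × Rule ℕ ℕ) × ℕ =>
      q.1.1.2.drop (q.2 + q.1.2.1.length) :=
    list_drop.comp (nat_add.comp snd (list_length.comp (fst.comp hp))) hz
  have ht : Primrec fun q : ((List (Rule ℕ ℕ) × Word ℕ) × Rule ℕ ℕ) × ℕ => q.1.1.2.take q.2 :=
    list_take.comp snd hz
  exact ite (Primrec.eq.comp (list_drop.comp snd hz) (list_append.comp (fst.comp hp) hd))
    (option_some.comp (pair (primrec_act.comp (fst.comp (snd.comp hp)) (primrec_invRev.comp ht))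
      (list_append.comp (list_append.comp ht (snd.comp (snd.comp hp))) hd))) (.const none)

lemma primrec_onePass : Primrec₂ (onePass : List (Rule ℕ ℕ) → YSeq ℕ ℕ × Word ℕ → _) := by
  have h : Primrec fun q : List (Rule ℕ ℕ) × (YSeq ℕ ℕ × Word ℕ) =>
      (redexes q.1 q.2.2).head? :=
    list_head?.comp (primrec_redexes.comp fst (snd.comp snd))
  refine (option_casesOn h snd (g := fun q t => (q.2.1 ++ t.1, t.2)) ?_).of_eq ?_
  · exact (pair (list_append.comp (fst.comp (snd.comp fst)) (fst.comp snd)) (snd.comp snd)).to₂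
  · intro q
    simp only [onePass]
    cases (redexes q.1 q.2.2).head? <;> rfl

lemma primrec_reduceFuel : Primrec fun q : List (Rule ℕ ℕ) × ℕ × Word ℕ =>
    reduceFuel q.1 q.2.1 q.2.2 :=
  nat_iterate (fst.comp snd) (pair (.const []) (snd.comp snd))
    (primrec_onePass.comp (fst.comp fst) snd).to₂

lemma primrec_criticalPairs : Primrec₂ (criticalPairs : Rule ℕ ℕ → Rule ℕ ℕ → _) := by
  refine list_append.comp (list_map (primrec_redexes.comp (list_cons.comp fst (.const []))
    (fst.comp snd)) (pair snd (snd.comp (snd.comp fst))).to₂) ?_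
  refine listFilterMap (list_range.comp (list_length.comp (fst.comp snd))) (Primrec₂.mk ?_)
  have hp : Primrec fun q : (Rule ℕ ℕ × Rule ℕ ℕ) × ℕ => q.1.1 := fst.comp fst
  have hq : Primrec fun q : (Rule ℕ ℕ × Rule ℕ ℕ) × ℕ => q.1.2 := snd.comp fst
  have hd : Primrec fun q : (Rule ℕ ℕ × Rule ℕ ℕ) × ℕ =>
      q.1.1.1.drop (q.1.2.1.length - q.2) :=
    list_drop.comp (nat_sub.comp (list_length.comp (fst.comp hq)) snd) (fst.comp hp)
  have ht : Primrec fun q : (Rule ℕ ℕ × Rule ℕ ℕ) × ℕ => q.1.2.1.take q.2 :=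
    list_take.comp snd (fst.comp hq)
  exact ite (Primrec.eq.comp (fst.comp hp)
      (list_append.comp (list_drop.comp snd (fst.comp hq)) hd))
    (option_some.comp (pair
      (pair (primrec_act.comp (fst.comp (snd.comp hp)) (primrec_invRev.comp ht))
        (list_append.comp ht (snd.comp (snd.comp hp))))
      (pair (fst.comp (snd.comp hq)) (list_append.comp (snd.comp (snd.comp hq)) hd))))
    (.const none)

lemma primrec_allPairs : Primrec (allPairs : List (Rule ℕ ℕ) → _) :=
  list_flatMap .id (list_flatMap fst (primrec_criticalPairs.comp (snd.comp fst) snd).to₂).to₂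

lemma primrec_reducedPairs : Primrec₂ (reducedPairs : List (Rule ℕ ℕ) → ℕ → _) := by
  refine list_map (primrec_allPairs.comp fst) (Primrec₂.mk ?_)
  have key : Primrec fun q : (List (Rule ℕ ℕ) × ℕ) × (YSeq ℕ ℕ × Word ℕ) =>
      reduceState q.1.1 q.1.2 q.2 := by
    have h : Primrec fun q : (List (Rule ℕ ℕ) × ℕ) × (YSeq ℕ ℕ × Word ℕ) =>
        reduceFuel q.1.1 q.1.2 q.2.2 :=
      primrec_reduceFuel.comp (pair (fst.comp fst) (pair (snd.comp fst) (snd.comp snd)))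
    exact pair (list_append.comp (fst.comp snd) (fst.comp h)) (snd.comp h)
  exact pair (key.comp (pair fst (fst.comp snd))) (key.comp (pair fst (snd.comp snd)))

lemma primrec_list_isEmpty {σ : Type*} [Primcodable σ] : Primrec (List.isEmpty : List σ → Bool) :=
  (list_casesOn .id (.const true) (h := fun _ _ => false) (.const false)).of_eq fun l => by
    cases l <;> rfl

lemma primrec_all {α β : Type*} [Primcodable α] [Primcodable β] {f : α → List β}
    {g : α → β → Bool} (hf : Primrec f) (hg : Primrec₂ g) :
    Primrec fun a => (f a).all (g a) := by
  refine (list_foldr hf (.const true) (h := fun a q => g a q.1 && q.2) ?_).of_eq fun a => ?_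
  · exact Primrec.and.comp (hg.comp fst (fst.comp snd)) (snd.comp snd)
  · induction f a with
    | nil => rfl
    | cons b l ih => rw [List.foldr_cons, ih, List.all_cons]

lemma primrec_enough : Primrec fun q : List (Rule ℕ ℕ) × ℕ × List (Word ℕ) =>
    enough q.1 q.2.1 q.2.2 := by
  refine primrec_all (snd.comp snd) (Primrec₂.mk (primrec_list_isEmpty.comp ?_))
  exact primrec_redexes.comp (fst.comp fst) (snd.comp (primrec_reduceFuel.comp
    (pair (fst.comp fst) (pair (fst.comp (snd.comp fst)) snd))))

lemma primrec_pairWords : Primrec (pairWords : List (Rule ℕ ℕ) → _) := by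
  have h : Primrec fun t : (YSeq ℕ ℕ × Word ℕ) × (YSeq ℕ ℕ × Word ℕ) => [t.1.2, t.2.2] :=
    list_cons.comp (snd.comp fst) (list_cons.comp (snd.comp snd) (.const []))
  exact list_flatMap (g := fun _ t => [t.1.2, t.2.2]) primrec_allPairs (.mk (h.comp snd))

lemma primrec_irreducible_extensions :
    Primrec fun q : (List (ℕ × Bool) × List (Rule ℕ ℕ)) × Word ℕ =>
      (q.1.1.map fun y => q.2 ++ [y]).filter fun z => (redexes q.1.2 z).isEmpty := by
  have h1 : Primrec fun q : (List (ℕ × Bool) × List (Rule ℕ ℕ)) × Word ℕ =>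
      q.1.1.map fun y => q.2 ++ [y] :=
    list_map (fst.comp fst) (.mk (list_concat.comp (snd.comp fst) snd))
  have h2 : Primrec fun q : ((List (ℕ × Bool) × List (Rule ℕ ℕ)) × Word ℕ) × Word ℕ =>
      (redexes q.1.1.2 q.2).isEmpty :=
    primrec_list_isEmpty.comp (primrec_redexes.comp (snd.comp (fst.comp fst)) snd)
  have h3 : Primrec₂ fun (q : (List (ℕ × Bool) × List (Rule ℕ ℕ)) × Word ℕ) (z : Word ℕ) =>
      bif (redexes q.1.2 z).isEmpty then some z else none :=
    .mk (cond h2 (option_some.comp snd) (.const none))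
  refine (listFilterMap h1 h3).of_eq fun q => ?_
  rw [← List.filterMap_eq_filter]
  refine List.filterMap_congr fun z _ => ?_
  simp only [Option.guard, Bool.cond_eq_ite]

lemma primrec_level : Primrec fun q : (List (ℕ × Bool) × List (Rule ℕ ℕ)) × ℕ =>
    level q.1.1 q.1.2 q.2 := by
  have h : Primrec₂ fun (q : (List (ℕ × Bool) × List (Rule ℕ ℕ)) × ℕ)
      (r : ℕ × List (Word ℕ)) => r.2.flatMap fun z =>
        (q.1.1.map fun y => z ++ [y]).filter fun z => (redexes q.1.2 z).isEmpty :=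
    .mk (list_flatMap (snd.comp snd)
      (.mk (primrec_irreducible_extensions.comp (pair (fst.comp (fst.comp fst)) snd))))
  exact (nat_rec' (f := fun q : (List (ℕ × Bool) × List (Rule ℕ ℕ)) × ℕ => q.2)
    (g := fun _ => [[]]) snd (.const _) h).of_eq fun _ => rfl

lemma primrec_levels : Primrec fun q : (List (ℕ × Bool) × List (Rule ℕ ℕ)) × ℕ =>
    levels q.1.1 q.1.2 q.2 :=
  list_flatMap (list_range.comp snd) (primrec_level.comp (pair (fst.comp fst) snd)).to₂

lemma primrec_edgeWord : Primrec fun q : (List (Rule ℕ ℕ) × ℕ) × Word ℕ × ℕ =>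
    edgeWord q.1.1 q.1.2 q.2.1 q.2.2 := by
  have h : Primrec fun q : (List (Rule ℕ ℕ) × ℕ) × Word ℕ × ℕ => q.2.1 ++ [(q.2.2, true)] :=
    list_concat.comp (fst.comp snd) (pair (snd.comp snd) (.const true))
  exact list_append.comp h (primrec_invRev.comp (snd.comp (primrec_reduceFuel.comp
    (pair (fst.comp fst) (pair (snd.comp fst) h)))))

lemma primrec_edgeFuel : Primrec fun q : (List (Rule ℕ ℕ) × ℕ) × Word ℕ × ℕ =>
    edgeFuel q.1.1 q.1.2 q.2.1 q.2.2 :=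
  fst.comp (primrec_reduceFuel.comp (pair (fst.comp fst) (pair (snd.comp fst) primrec_edgeWord)))

lemma primrec_traverse :
    Primrec fun q : (List (Rule ℕ ℕ) × ℕ) × (YSeq ℕ ℕ × Word ℕ) × (ℕ × Bool) =>
      traverse q.1.1 q.1.2 q.2.1 q.2.2 := by
  have hz : Primrec fun q : (List (Rule ℕ ℕ) × ℕ) × (YSeq ℕ ℕ × Word ℕ) × (ℕ × Bool) =>
      q.2.1.2 := snd.comp (fst.comp snd)
  have hy : Primrec fun q : (List (Rule ℕ ℕ) × ℕ) × (YSeq ℕ ℕ × Word ℕ) × (ℕ × Bool) =>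
      q.2.2 := snd.comp snd
  have hn : Primrec fun q : (List (Rule ℕ ℕ) × ℕ) × (YSeq ℕ ℕ × Word ℕ) × (ℕ × Bool) =>
      (reduceFuel q.1.1 q.1.2 (q.2.1.2 ++ [q.2.2])).2 :=
    snd.comp (primrec_reduceFuel.comp (pair (fst.comp fst) (pair (snd.comp fst)
      (list_concat.comp hz hy))))
  exact pair (list_append.comp (fst.comp (fst.comp snd)) (cond (snd.comp hy)
    (primrec_edgeFuel.comp (pair fst (pair hz (fst.comp hy))))
    (primrec_inverse.comp (primrec_edgeFuel.comp (pair fst (pair hn (fst.comp hy))))))) hn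

lemma primrec_sepFuel : Primrec fun q : (List (Rule ℕ ℕ) × ℕ) × Word ℕ × (ℕ × Word ℕ) =>
    sepFuel q.1.1 q.1.2 q.2.1 q.2.2 := by
  have h : Primrec fun q : (List (Rule ℕ ℕ) × ℕ) × Word ℕ × (ℕ × Word ℕ) =>
      q.2.2.2.foldl (traverse q.1.1 q.1.2) ([], q.2.1) :=
    list_foldl (snd.comp (snd.comp snd)) (pair (.const []) (fst.comp snd))
      (primrec_traverse.comp (pair (fst.comp fst) snd)).to₂
  exact list_append.comp (primrec_inverse.comp (fst.comp h)) (list_cons.comp (pair (pair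
    (fst.comp (snd.comp snd)) (primrec_invRev.comp (fst.comp snd))) (.const true)) (.const []))

lemma primrec_edgeWords :
    Primrec fun q : (List (ℕ × Bool) × List (Rule ℕ ℕ) × List (Word ℕ)) × ℕ =>
      edgeWords q.1.1 q.1.2.1 q.1.2.2 q.2 := by
  refine list_flatMap (snd.comp (snd.comp fst)) (Primrec₂.mk ?_)
  refine list_flatMap (fst.comp (fst.comp fst)) (Primrec₂.mk ?_)
  have h : Primrec fun q : (((List (ℕ × Bool) × List (Rule ℕ ℕ) × List (Word ℕ)) × ℕ) ×
      Word ℕ) × (ℕ × Bool) => edgeWord q.1.1.1.2.1 q.1.1.2 q.1.2 q.2.1 :=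
    primrec_edgeWord.comp (f := fun q : (List (Rule ℕ ℕ) × ℕ) × Word ℕ × ℕ =>
      edgeWord q.1.1 q.1.2 q.2.1 q.2.2)
      (pair (pair (fst.comp (snd.comp (fst.comp (fst.comp fst)))) (snd.comp (fst.comp fst)))
      (pair (snd.comp fst) (fst.comp snd)))
  have h' : Primrec fun q : (((List (ℕ × Bool) × List (Rule ℕ ℕ) × List (Word ℕ)) × ℕ) ×
      Word ℕ) × (ℕ × Bool) => q.1.2 ++ [q.2] := list_concat.comp (snd.comp fst) snd
  exact list_cons.comp h' (list_cons.comp h (.const []))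

lemma primrec_rawLetters : Primrec rawLetters :=
  list_flatMap list_range (list_cons.comp (pair snd (.const true))
    (list_cons.comp (pair snd (.const false)) (.const []))).to₂

lemma primrec_labelled : Primrec labelled :=
  list_map (list_range.comp list_length) (pair snd ((list_getD []).comp fst snd)).to₂

lemma primrec_rawInitial : Primrec rawInitial := by
  refine list_append.comp (list_flatMap (list_range.comp fst) (Primrec₂.mk ?_)) ?_
  · have h : ∀ b : Bool, Primrec fun q : (ℕ × List (Word ℕ)) × ℕ =>
        (([(q.2, b), (q.2, !b)], [], []) : Rule ℕ ℕ) := fun b =>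
      pair (list_cons.comp (pair snd (.const b)) (list_cons.comp (pair snd (.const !b))
        (.const []))) (.const ([], []))
    exact list_cons.comp (h true) (list_cons.comp (h false) (Primrec.const []))
  · have h : Primrec fun l : List (ℕ × Word ℕ) => l.filter fun q => !q.2.isEmpty :=
      (listFilter (p := fun q : ℕ × Word ℕ => (!q.2.isEmpty) = true) (Primrec.eq.comp
        (Primrec.not.comp (primrec_list_isEmpty.comp snd)) (.const true))).of_eq fun l => by
          simp only [Bool.decide_eq_true]
    refine list_map (h.comp (primrec_labelled.comp snd)) (Primrec₂.mk ?_)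
    exact pair (snd.comp snd) (pair (list_cons.comp (pair (pair (fst.comp snd) (.const []))
        (.const true)) (.const [])) (.const []))

end Primrec

/-! ### Unbounded searches and partial recursiveness. -/

section Partrec

/-- Search for the first `k` with `p k`, and return `f k`. -/
def search {σ : Type*} (p : ℕ → Bool) (f : ℕ → σ) : Part σ :=
  (Nat.rfind fun k => Part.some (p k)).map f

/-- Which `k` is found is left open; for bounds on the number of passes any successful one gives the
same answer. -/
lemma exists_search_eq {σ : Type*} {p : ℕ → Bool} (f : ℕ → σ) (h : ∃ k, p k = true) :
    ∃ k, p k = true ∧ search p f = Part.some (f k) := by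
  classical
  have hmem : Nat.find h ∈ Nat.rfind fun k => Part.some (p k) := by
    refine Nat.mem_rfind.2 ⟨?_, fun {j} hj => ?_⟩
    · simpa using (Nat.find_spec h).symm
    · simpa using Nat.find_min h hj
  exact ⟨_, Nat.find_spec h, by rw [search, Part.eq_some_iff.2 hmem, Part.map_some]⟩

variable {α β σ : Type*} [Primcodable α] [Primcodable β] [Primcodable σ]

/-- Orienting pairs uses the given ordering, which is assumed only computable, so the primitive
recursive `list_flatMap` does not apply. The list is processed by recursion on its length. -/
lemma computable_flatMap {f : α → List β} {g : α → β → List σ} (hf : Computable f)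
    (hg : Computable₂ g) : Computable fun a => (f a).flatMap (g a) := by
  have h : Computable fun a => ((f a).length.rec [] fun i acc =>
      ((f a)[i]?).casesOn acc fun b => acc ++ g a b : List σ) := by
    refine Computable.nat_rec (h := fun a q => ((f a)[q.1]?).casesOn q.2 fun b => q.2 ++ g a b)
      (Computable.list_length.comp hf) (.const []) (Computable₂.mk ?_)
    refine Computable.option_casesOn (Computable.list_getElem?.comp (hf.comp .fst)
      (Computable.fst.comp .snd)) (Computable.snd.comp .snd) (Computable₂.mk ?_)
    exact Computable.list_append.comp (Computable.snd.comp (Computable.snd.comp .fst))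
      (hg.comp (Computable.fst.comp .fst) .snd)
  refine h.of_eq fun a => ?_
  -- After `i` rounds exactly the first `i` entries have been processed; the bound on `i` rules out
  -- a failing lookup.
  have key : ∀ i, i ≤ (f a).length → (i.rec [] fun i acc =>
      ((f a)[i]?).casesOn acc fun b => acc ++ g a b : List σ) = ((f a).take i).flatMap (g a) := by
    intro i hi
    induction i with
    | zero => rfl
    | succ i ih =>
      have hi' : i < (f a).length := hi
      rw [List.take_add_one, List.flatMap_append, ← ih hi'.le]
      simp [List.getElem?_eq_getElem hi']
  rw [key _ le_rfl, List.take_length]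

lemma partrec₂_mk {f : α → β →. σ} (hf : Partrec fun p : α × β => f p.1 p.2) : Partrec₂ f := hf

lemma partrec_search {p : α → ℕ → Bool} {f : α → ℕ → σ} (hp : Computable₂ p)
    (hf : Computable₂ f) : Partrec fun a => search (p a) (f a) :=
  (Partrec.rfind hp.partrec₂).map hf

lemma computable_orient {gt : α → Word ℕ → Word ℕ → Prop}
    (hgt : ComputablePred fun q : α × Word ℕ × Word ℕ => gt q.1 q.2.1 q.2.2) :
    Computable₂ fun (a : α) (t : (YSeq ℕ ℕ × Word ℕ) × (YSeq ℕ ℕ × Word ℕ)) =>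
      orient (gt a) t := by
  classical
  obtain ⟨_, hD⟩ := hgt
  have hD1 : Computable fun q : α × (YSeq ℕ ℕ × Word ℕ) × (YSeq ℕ ℕ × Word ℕ) =>
      decide (gt q.1 q.2.1.2 q.2.2.2) :=
    (hD.comp (Computable.pair .fst (Computable.pair
      (snd.comp (fst.comp snd)).to_comp (snd.comp (snd.comp snd)).to_comp))).of_eq
      fun _ => decide_eq_decide.2 Iff.rfl
  have hD2 : Computable fun q : α × (YSeq ℕ ℕ × Word ℕ) × (YSeq ℕ ℕ × Word ℕ) =>
      decide (gt q.1 q.2.2.2 q.2.1.2) :=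
    (hD.comp (Computable.pair .fst (Computable.pair
      (snd.comp (snd.comp snd)).to_comp (snd.comp (fst.comp snd)).to_comp))).of_eq
      fun _ => decide_eq_decide.2 Iff.rfl
  have hr : Primrec fun t : (YSeq ℕ ℕ × Word ℕ) × (YSeq ℕ ℕ × Word ℕ) =>
      ([(t.1.2, t.1.1.inverse ++ t.2.1, t.2.2)] : List (Rule ℕ ℕ)) :=
    list_cons.comp (pair (snd.comp fst) (pair (list_append.comp
      (primrec_inverse.comp (fst.comp fst)) (fst.comp snd)) (snd.comp snd))) (.const [])
  refine (Computable.cond hD1 (hr.to_comp.comp .snd) (Computable.cond hD2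
    (hr.comp (pair (snd.comp snd) (fst.comp snd))).to_comp (.const []))).of_eq fun q => ?_
  simp only [orient, Bool.cond_decide]

lemma computable_newRulesFuel {gt : α → Word ℕ → Word ℕ → Prop}
    (hgt : ComputablePred fun q : α × Word ℕ × Word ℕ => gt q.1 q.2.1 q.2.2) :
    Computable fun q : (α × List (Rule ℕ ℕ)) × ℕ => newRulesFuel (gt q.1.1) q.1.2 q.2 :=
  computable_flatMap (primrec_reducedPairs.comp (snd.comp fst) snd).to_comp
    ((computable_orient hgt).comp (fst.comp (fst.comp fst)).to_comp .snd).to₂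

/-- The rules which a pass of the completion procedure adds. -/
noncomputable def newRulesPart (gt : Word ℕ → Word ℕ → Prop) (R : List (Rule ℕ ℕ)) :
    Part (List (Rule ℕ ℕ)) :=
  search (fun k => enough R k (pairWords R)) (newRulesFuel gt R)

/-- The result of `k` passes of the completion procedure. -/
noncomputable def iteratePart (gt : Word ℕ → Word ℕ → Prop) (R : List (Rule ℕ ℕ)) (k : ℕ) :
    Part (List (Rule ℕ ℕ)) :=
  k.rec (Part.some R) fun _ R => R.bind fun R => (newRulesPart gt R).map (R ++ ·)

/-- The completion procedure. -/
noncomputable def completePart (gt : Word ℕ → Word ℕ → Prop) (R : List (Rule ℕ ℕ)) :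
    Part (List (Rule ℕ ℕ)) :=
  (Nat.rfind fun k => (iteratePart gt R k).bind fun R =>
    (newRulesPart gt R).map List.isEmpty).bind (iteratePart gt R)

/-- Reduction of a word to an irreducible word. -/
def reducePart (R : List (Rule ℕ ℕ)) (z : Word ℕ) : Part (YSeq ℕ ℕ × Word ℕ) :=
  search (fun k => enough R k [z]) fun k => reduceFuel R k z

/-- The information for an edge of the Cayley graph. -/
def edgePart (R : List (Rule ℕ ℕ)) (z : Word ℕ) (x : ℕ) : Part (YSeq ℕ ℕ) :=
  (reducePart R z).bind fun s => (reducePart R (s.2 ++ [(x, true)])).bind fun t =>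
    (reducePart R (s.2 ++ [(x, true)] ++ FreeGroup.invRev t.2)).map Prod.fst

/-- The list of all irreducible words. -/
def irreduciblePart (L : List (ℕ × Bool)) (R : List (Rule ℕ ℕ)) : Part (List (Word ℕ)) :=
  search (fun i => (level L R i).isEmpty) (levels L R)

/-- The list of the separation elements. -/
def sepPart (L : List (ℕ × Bool)) (R : List (Rule ℕ ℕ)) (E : List (Word ℕ))
    (l : List (ℕ × Word ℕ)) : Part (List (YSeq ℕ ℕ)) :=
  search (fun k => enough R k (edgeWords L R E k)) fun k =>
    E.flatMap fun z => l.map fun p => sepFuel R k z p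

variable {gt : α → Word ℕ → Word ℕ → Prop}

lemma partrec_newRulesPart
    (hgt : ComputablePred fun q : α × Word ℕ × Word ℕ => gt q.1 q.2.1 q.2.2) :
    Partrec fun q : α × List (Rule ℕ ℕ) => newRulesPart (gt q.1) q.2 :=
  partrec_search (primrec_enough.comp (pair (snd.comp fst) (pair snd
    (primrec_pairWords.comp (snd.comp fst))))).to₂.to_comp (computable_newRulesFuel hgt).to₂

lemma partrec_iteratePart
    (hgt : ComputablePred fun q : α × Word ℕ × Word ℕ => gt q.1 q.2.1 q.2.2) :
    Partrec₂ fun (q : α × List (Rule ℕ ℕ)) (k : ℕ) => iteratePart (gt q.1) q.2 k := by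
  have h : Partrec₂ fun (q : (α × List (Rule ℕ ℕ)) × ℕ) (r : ℕ × List (Rule ℕ ℕ)) =>
      (newRulesPart (gt q.1.1) r.2).map (r.2 ++ ·) := by
    have hq : Computable fun q : ((α × List (Rule ℕ ℕ)) × ℕ) × (ℕ × List (Rule ℕ ℕ)) =>
        (q.1.1.1, q.2.2) :=
      Computable.pair (fst.comp (fst.comp fst)).to_comp (snd.comp snd).to_comp
    have ha : Computable₂ fun (q : ((α × List (Rule ℕ ℕ)) × ℕ) × (ℕ × List (Rule ℕ ℕ)))
        (R : List (Rule ℕ ℕ)) => q.2.2 ++ R :=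
      (list_append.comp (snd.comp (snd.comp fst)) snd).to₂.to_comp
    have hn := (partrec_newRulesPart hgt).comp hq
    exact partrec₂_mk (hn.map ha)
  exact (Partrec.nat_rec (f := fun q : (α × List (Rule ℕ ℕ)) × ℕ => q.2)
    (g := fun q => Part.some q.1.2) .snd (Computable.snd.comp .fst).partrec h).of_eq fun _ => rfl

lemma partrec_completePart
    (hgt : ComputablePred fun q : α × Word ℕ × Word ℕ => gt q.1 q.2.1 q.2.2) :
    Partrec fun q : α × List (Rule ℕ ℕ) => completePart (gt q.1) q.2 := by
  refine Partrec.bind (Partrec.rfind (partrec₂_mk ?_)) (partrec_iteratePart hgt)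
  refine Partrec.bind (partrec_iteratePart hgt) (partrec₂_mk ?_)
  exact ((partrec_newRulesPart hgt).comp (Computable.pair (fst.comp (fst.comp fst)).to_comp
    .snd)).map (primrec_list_isEmpty.comp snd).to₂.to_comp

lemma partrec_reducePart : Partrec₂ reducePart :=
  partrec_search (primrec_enough.comp (pair (fst.comp fst) (pair snd
    (list_cons.comp (snd.comp fst) (.const []))))).to₂.to_comp
    (primrec_reduceFuel.comp (pair (fst.comp fst) (pair snd (snd.comp fst)))).to₂.to_comp

lemma partrec_edgePart : Partrec fun q : List (Rule ℕ ℕ) × Word ℕ × ℕ =>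
    edgePart q.1 q.2.1 q.2.2 := by
  refine Partrec.bind (partrec_reducePart.comp .fst (Computable.fst.comp .snd))
    (partrec₂_mk ?_)
  have h : Primrec fun q : (List (Rule ℕ ℕ) × Word ℕ × ℕ) × (YSeq ℕ ℕ × Word ℕ) =>
      q.2.2 ++ [(q.1.2.2, true)] :=
    list_concat.comp (snd.comp snd) (pair (snd.comp (snd.comp fst)) (.const true))
  refine Partrec.bind (partrec_reducePart.comp (Computable.fst.comp .fst) h.to_comp)
    (partrec₂_mk ?_)
  refine Partrec.map (partrec_reducePart.comp (fst.comp (fst.comp fst)).to_comp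
    (list_append.comp (h.comp fst) (primrec_invRev.comp (snd.comp snd))).to_comp) ?_
  exact (fst.comp snd).to₂.to_comp

lemma partrec_irreduciblePart : Partrec₂ irreduciblePart :=
  partrec_search (primrec_list_isEmpty.comp primrec_level).to₂.to_comp primrec_levels.to₂.to_comp

lemma primrec_enough_edgeWords :
    Primrec fun q : (List (ℕ × Bool) × List (Rule ℕ ℕ) × List (Word ℕ)) × ℕ =>
      enough q.1.2.1 q.2 (edgeWords q.1.1 q.1.2.1 q.1.2.2 q.2) :=
  primrec_enough.comp (f := fun q : List (Rule ℕ ℕ) × ℕ × List (Word ℕ) => enough q.1 q.2.1 q.2.2)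
    (g := fun q : (List (ℕ × Bool) × List (Rule ℕ ℕ) × List (Word ℕ)) × ℕ =>
      (q.1.2.1, q.2, edgeWords q.1.1 q.1.2.1 q.1.2.2 q.2))
    (pair (fst.comp (snd.comp fst)) (pair snd primrec_edgeWords))

lemma primrec_sepFuel_list :
    Primrec fun q : ((List (Rule ℕ ℕ) × ℕ) × List (ℕ × Word ℕ)) × List (Word ℕ) =>
      q.2.flatMap fun z => q.1.2.map fun p => sepFuel q.1.1.1 q.1.1.2 z p := by
  have h : Primrec fun q : ((((List (Rule ℕ ℕ) × ℕ) × List (ℕ × Word ℕ)) × List (Word ℕ)) ×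
      Word ℕ) × (ℕ × Word ℕ) => sepFuel q.1.1.1.1.1 q.1.1.1.1.2 q.1.2 q.2 :=
    primrec_sepFuel.comp
      (f := fun q : (List (Rule ℕ ℕ) × ℕ) × Word ℕ × (ℕ × Word ℕ) =>
        sepFuel q.1.1 q.1.2 q.2.1 q.2.2)
      (g := fun q : ((((List (Rule ℕ ℕ) × ℕ) × List (ℕ × Word ℕ)) × List (Word ℕ)) ×
        Word ℕ) × (ℕ × Word ℕ) => ((q.1.1.1.1.1, q.1.1.1.1.2), q.1.2, q.2))
      (pair (fst.comp (fst.comp (fst.comp fst))) (pair (snd.comp fst) snd))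
  exact list_flatMap snd (.mk (list_map (snd.comp (fst.comp fst)) (.mk h)))

lemma partrec_sepPart :
    Partrec fun q : (List (ℕ × Bool) × List (Rule ℕ ℕ) × List (Word ℕ)) × List (ℕ × Word ℕ) =>
      sepPart q.1.1 q.1.2.1 q.1.2.2 q.2 := by
  have h1 := primrec_enough_edgeWords.comp (g := fun q : ((List (ℕ × Bool) × List (Rule ℕ ℕ) ×
      List (Word ℕ)) × List (ℕ × Word ℕ)) × ℕ => (q.1.1, q.2)) (pair (fst.comp fst) snd)
  have hR : Primrec fun q : ((List (ℕ × Bool) × List (Rule ℕ ℕ) × List (Word ℕ)) ×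
      List (ℕ × Word ℕ)) × ℕ => q.1.1.2.1 := fst.comp (snd.comp (fst.comp fst))
  have hE : Primrec fun q : ((List (ℕ × Bool) × List (Rule ℕ ℕ) × List (Word ℕ)) ×
      List (ℕ × Word ℕ)) × ℕ => q.1.1.2.2 := snd.comp (snd.comp (fst.comp fst))
  have hl : Primrec fun q : ((List (ℕ × Bool) × List (Rule ℕ ℕ) × List (Word ℕ)) ×
      List (ℕ × Word ℕ)) × ℕ => q.1.2 := snd.comp fst
  have h2 := primrec_sepFuel_list.comp (((hR.pair snd).pair hl).pair hE)
  have h3 : Computable₂ fun (q : (List (ℕ × Bool) × List (Rule ℕ ℕ) × List (Word ℕ)) ×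
      List (ℕ × Word ℕ)) k =>
      enough q.1.2.1 k (edgeWords q.1.1 q.1.2.1 q.1.2.2 k) := .mk h1.to_comp
  have h4 : Computable₂ fun (q : (List (ℕ × Bool) × List (Rule ℕ ℕ) × List (Word ℕ)) ×
      List (ℕ × Word ℕ)) k =>
      q.1.2.2.flatMap fun z => q.2.map fun p => sepFuel q.1.2.1 k z p := .mk h2.to_comp
  exact partrec_search h3 h4

end Partrec

end IdRel

namespace IdRel

/-! ### Correctness of the searches on encoded presentations. -/

section Algorithms

variable {n m : ℕ} {w : Fin m → Word (Fin n)}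

lemma newRulesPart_raw {gt : Word ℕ → Word ℕ → Prop} {R : List (Rule (Fin n) (Fin m))}
    (hR : Terminates R) : newRulesPart gt (R.map rawRule) =
      Part.some ((newRules (fun u v => gt (rawWord u) (rawWord v)) R).map rawRule) := by
  obtain ⟨K, hK⟩ := hR.exists_enough (pairWords R)
  obtain ⟨k, hk, e⟩ := exists_search_eq (newRulesFuel gt (R.map rawRule))
    (p := fun k => enough (R.map rawRule) k (pairWords (R.map rawRule)))
    ⟨K, by rw [pairWords_raw, enough_raw, hK K le_rfl]⟩
  rw [pairWords_raw, enough_raw] at hk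
  rw [newRulesPart, e, newRulesFuel_raw, newRulesFuel_eq hk]

lemma reducePart_raw {R : List (Rule (Fin n) (Fin m))} (hR : Terminates R) (z : Word (Fin n)) :
    reducePart (R.map rawRule) (rawWord z) = Part.some (rawState (reduceWord2 R z)) := by
  have h1 : [rawWord z] = [z].map rawWord := rfl
  obtain ⟨K, hK⟩ := hR.exists_enough [z]
  obtain ⟨k, hk, e⟩ := exists_search_eq (fun k => reduceFuel (R.map rawRule) k (rawWord z))
    (p := fun k => enough (R.map rawRule) k [rawWord z])
    ⟨K, by rw [h1, enough_raw, hK K le_rfl]⟩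
  rw [h1, enough_raw] at hk
  rw [reducePart, e, reduceFuel_raw, reduceFuel_eq_of_enough hk (by simp)]

/-- The first reduction replaces the arbitrary word `z` by the normal form of its class, which makes
the output depend only on the group element. -/
lemma edgePart_raw {R : List (Rule (Fin n) (Fin m))} (h : IsCompleteEIRS w R)
    {N : Grp (relators w) → Word (Fin n)} (hN : IsNormalForm w (R1 R) N) (z : Word (Fin n))
    (x : Fin n) : edgePart (R.map rawRule) (rawWord z) x =
      Part.some (rawYSeq (edgeInfo w R N (val w z) x)) := by
  have hT : Terminates R := h.complete.1
  have e : [((x : ℕ), true)] = rawWord [(x, true)] := rfl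
  rw [edgePart, reducePart_raw hT, Part.bind_some]
  simp only [rawState, reduceWord2_eq_normalForm hT h.eirs hN, e, ← rawWord_append]
  rw [reducePart_raw hT, Part.bind_some]
  simp only [rawState, reduceWord2_eq_normalForm hT h.eirs hN, ← rawWord_append, invRev_rawWord]
  rw [reducePart_raw hT, Part.map_some, val_append, hN.val_eq]
  rfl

lemma iteratePart_succ (gt : Word ℕ → Word ℕ → Prop) (R : List (Rule ℕ ℕ)) (k : ℕ) :
    iteratePart gt R (k + 1) =
      (iteratePart gt R k).bind fun R => (newRulesPart gt R).map (R ++ ·) := rfl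

lemma iteratePart_raw {gt : Word ℕ → Word ℕ → Prop}
    (hgt : IsAdmissibleWellOrder fun u v : Word (Fin n) => gt (rawWord u) (rawWord v)) (k : ℕ) :
    iteratePart gt (rawInitial (rawPres w)) k = Part.some
      ((iterateKB2 w (fun u v => gt (rawWord u) (rawWord v)) k).map rawRule) := by
  induction k with
  | zero => exact congrArg Part.some (rawInitial_rawPres w)
  | succ k ih =>
    have hT := (isOrientedSystem_iterateKB2 (w := w) hgt k).oriented.terminates hgt
    rw [iteratePart_succ, ih, Part.bind_some, newRulesPart_raw hT, Part.map_some,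
      iterateKB2_succ, onePassKB2, List.map_append]

lemma completePart_raw {gt : Word ℕ → Word ℕ → Prop}
    (hgt : IsAdmissibleWellOrder fun u v : Word (Fin n) => gt (rawWord u) (rawWord v)) {k : ℕ}
    (hk : newRules (fun u v => gt (rawWord u) (rawWord v))
      (iterateKB2 w (fun u v => gt (rawWord u) (rawWord v)) k) = [])
    (hlt : ∀ j < k, newRules (fun u v => gt (rawWord u) (rawWord v))
      (iterateKB2 w (fun u v => gt (rawWord u) (rawWord v)) j) ≠ []) :
    completePart gt (rawInitial (rawPres w)) = Part.some
      ((iterateKB2 w (fun u v => gt (rawWord u) (rawWord v)) k).map rawRule) := by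
  have hstep : ∀ j, ((iteratePart gt (rawInitial (rawPres w)) j).bind fun R =>
      (newRulesPart gt R).map List.isEmpty) = Part.some
      (newRules (fun u v => gt (rawWord u) (rawWord v))
      (iterateKB2 w (fun u v => gt (rawWord u) (rawWord v)) j)).isEmpty := by
    intro j
    have hT := (isOrientedSystem_iterateKB2 (w := w) hgt j).oriented.terminates hgt
    rw [iteratePart_raw hgt, Part.bind_some, newRulesPart_raw hT, Part.map_some,
      List.isEmpty_map]
  have hmem : k ∈ Nat.rfind fun j => (iteratePart gt (rawInitial (rawPres w)) j).bind fun R =>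
      (newRulesPart gt R).map List.isEmpty := by
    refine Nat.mem_rfind.2 ⟨?_, fun {j} hj => ?_⟩
    -- `Nat.rfind` also requires every earlier test to halt with answer false; earlier passes do
    -- terminate, and `hlt` says that they add rules.
    · rw [hstep, hk]
      exact Part.mem_some _
    · rw [hstep, List.isEmpty_eq_false_iff.2 (hlt j hj)]
      exact Part.mem_some _
  rw [completePart, Part.eq_some_iff.2 hmem, Part.bind_some, iteratePart_raw hgt]

/-- Every irreducible word is a value of `N`. For finite `G` the search for an empty level therefore
succeeds. -/
lemma finite_irred {R : List (Rule (Fin n) (Fin m))}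
    {N : Grp (relators w) → Word (Fin n)} (hN : IsNormalForm w (R1 R) N)
    [Finite (Grp (relators w))] : {z | Irred (R1 R) z}.Finite :=
  (Set.finite_range N).subset fun z hz => ⟨val w z, hN.eq_of_irred hz⟩

lemma irreduciblePart_raw {R : List (Rule (Fin n) (Fin m))} (h : IsCompleteEIRS w R)
    {N : Grp (relators w) → Word (Fin n)} (hN : IsNormalForm w (R1 R) N)
    [Finite (Grp (relators w))] : ∃ E : List (Word (Fin n)),
      irreduciblePart (rawLetters n) (R.map rawRule) = Part.some (E.map rawWord) ∧
      E.Nodup ∧ ∀ z, z ∈ E ↔ ∃ g, z = N g := by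
  have h0 := h.complete.irred_nil
  obtain ⟨K, hK⟩ := exists_level_eq_nil mem_letters h0 (finite_irred hN)
  obtain ⟨i, hi, e⟩ := exists_search_eq (levels (rawLetters n) (R.map rawRule))
    (p := fun i => (level (rawLetters n) (R.map rawRule) i).isEmpty)
    ⟨K, by rw [rawLetters_eq, level_raw, hK]; rfl⟩
  rw [rawLetters_eq, level_raw, List.isEmpty_map, List.isEmpty_iff] at hi
  refine ⟨levels (letters n) R i, ?_, levels_nodup mem_letters (letters_nodup n) h0 i, fun z => ?_⟩
  · rw [irreduciblePart, e, rawLetters_eq, levels_raw]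
  · rw [mem_levels mem_letters h0 hi]
    constructor
    · exact fun hz => ⟨val w z, (hN.eq_of_irred hz).symm⟩
    · rintro ⟨g, rfl⟩
      exact hN.irred g

lemma sepPart_raw {R : List (Rule (Fin n) (Fin m))} (h : IsCompleteEIRS w R)
    {N : Grp (relators w) → Word (Fin n)} (hN : IsNormalForm w (R1 R) N)
    {h1 : GroupoidHom (relators w)} (hh : IsDeterminedBy w R N h1) {E : List (Word (Fin n))}
    (hE : ∀ z, z ∈ E ↔ ∃ g, z = N g) : ∃ S : List (YSeq (Fin n) (Fin m)),
      sepPart (rawLetters n) (R.map rawRule) (E.map rawWord) (labelled (rawPres w).2) =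
        Part.some (S.map rawYSeq) ∧
      {c | ∃ s ∈ S, c = cls w s} = {c | ∃ g ρ, c = sep w N h1 g ρ} := by
  have hT : Terminates R := h.complete.1
  obtain ⟨K, hK⟩ := hT.exists_enough_edgeWords (letters n) E
  obtain ⟨k, hk, e⟩ := exists_search_eq
    (fun k => (E.map rawWord).flatMap fun z => (labelled (rawPres w).2).map fun p =>
      sepFuel (R.map rawRule) k z p)
    (p := fun k => enough (R.map rawRule) k
      (edgeWords (rawLetters n) (R.map rawRule) (E.map rawWord) k))
    ⟨K, by rw [rawLetters_eq, edgeWords_raw, enough_raw, hK]⟩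
  rw [rawLetters_eq, edgeWords_raw, enough_raw] at hk
  refine ⟨E.flatMap fun z => (List.finRange m).map fun ρ => sepFuel R k z (ρ, w ρ), ?_, ?_⟩
  · rw [sepPart, e, labelled_rawPres, List.flatMap_map, List.map_flatMap]
    simp only [List.map_map]
    congr 1
    refine List.flatMap_congr fun z _ => List.map_congr_left fun ρ _ => ?_
    exact sepFuel_raw R k z ρ (w ρ)
  · have key := h.cls_sepFuel hN hh mem_letters (fun g => (hE _).2 ⟨g, rfl⟩) hk
    ext c
    constructor
    · rintro ⟨s, hs, rfl⟩
      obtain ⟨z, hz, hs⟩ := List.mem_flatMap.1 hs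
      obtain ⟨ρ, _, rfl⟩ := List.mem_map.1 hs
      obtain ⟨g, rfl⟩ := (hE z).1 hz
      exact ⟨g, ρ, key g ρ⟩
    · rintro ⟨g, ρ, rfl⟩
      exact ⟨_, List.mem_flatMap.2 ⟨N g, (hE _).2 ⟨g, rfl⟩,
        List.mem_map.2 ⟨ρ, List.mem_finRange ρ, rfl⟩⟩, (key g ρ).symm⟩

end Algorithms

end IdRel

namespace IdRel

open Primrec

/-! ### The four uniform algorithms. -/

section Algorithms

variable {α : Type} [Primcodable α]

/-- The completion procedure on the encoding of a presentation. -/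
noncomputable def systemAlg (gt : α → Word ℕ → Word ℕ → Prop) (p : α × ℕ × List (Word ℕ)) :
    Part (List (Rule ℕ ℕ)) :=
  completePart (gt p.1) (rawInitial p.2)

/-- The normal form algorithm. -/
noncomputable def normalFormAlg (gt : α → Word ℕ → Word ℕ → Prop)
    (q : (α × ℕ × List (Word ℕ)) × Word ℕ) : Part (Word ℕ) :=
  (systemAlg gt q.1).bind fun R => (reducePart R q.2).map Prod.snd

/-- The algorithm for the morphism on an edge of the Cayley graph. -/
noncomputable def edgeAlg (gt : α → Word ℕ → Word ℕ → Prop)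
    (q : (α × ℕ × List (Word ℕ)) × Word ℕ × ℕ) : Part (YSeq ℕ ℕ) :=
  (systemAlg gt q.1).bind fun R => edgePart R q.2.1 q.2.2

/-- The algorithm for the elements of a finite group and for the separation elements. -/
noncomputable def identitiesAlg (gt : α → Word ℕ → Word ℕ → Prop) (p : α × ℕ × List (Word ℕ)) :
    Part (List (Word ℕ) × List (YSeq ℕ ℕ)) :=
  (systemAlg gt p).bind fun R => (irreduciblePart (rawLetters p.2.1) R).bind fun E =>
    (sepPart (rawLetters p.2.1) R E (labelled p.2.2)).map fun S => (E, S)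

variable {gt : α → Word ℕ → Word ℕ → Prop}

lemma partrec_systemAlg
    (hgt : ComputablePred fun q : α × Word ℕ × Word ℕ => gt q.1 q.2.1 q.2.2) :
    Partrec (systemAlg gt) := by
  have h : Computable fun p : α × ℕ × List (Word ℕ) => (p.1, rawInitial p.2) :=
    (pair fst (primrec_rawInitial.comp snd)).to_comp
  have h' := (partrec_completePart hgt).comp h
  exact h'

lemma partrec_normalFormAlg
    (hgt : ComputablePred fun q : α × Word ℕ × Word ℕ => gt q.1 q.2.1 q.2.2) :
    Partrec (normalFormAlg gt) := by
  have h : Partrec fun q : ((α × ℕ × List (Word ℕ)) × Word ℕ) × List (Rule ℕ ℕ) =>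
      reducePart q.2 q.1.2 :=
    partrec_reducePart.comp .snd (snd.comp fst).to_comp
  have h' : Partrec₂ fun (q : (α × ℕ × List (Word ℕ)) × Word ℕ) (R : List (Rule ℕ ℕ)) =>
      (reducePart R q.2).map Prod.snd :=
    partrec₂_mk (h.map (snd.comp snd).to₂.to_comp)
  exact ((partrec_systemAlg hgt).comp .fst).bind h'

lemma partrec_edgeAlg
    (hgt : ComputablePred fun q : α × Word ℕ × Word ℕ => gt q.1 q.2.1 q.2.2) :
    Partrec (edgeAlg gt) := by
  have hq : Computable fun q : ((α × ℕ × List (Word ℕ)) × Word ℕ × ℕ) × List (Rule ℕ ℕ) =>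
      (q.2, q.1.2) := (pair snd (snd.comp fst)).to_comp
  have h := partrec_edgePart.comp hq
  have h' : Partrec₂ fun (q : (α × ℕ × List (Word ℕ)) × Word ℕ × ℕ) (R : List (Rule ℕ ℕ)) =>
      edgePart R q.2.1 q.2.2 := partrec₂_mk h
  exact ((partrec_systemAlg hgt).comp .fst).bind h'

lemma partrec_identitiesAlg
    (hgt : ComputablePred fun q : α × Word ℕ × Word ℕ => gt q.1 q.2.1 q.2.2) :
    Partrec (identitiesAlg gt) := by
  have hL : Primrec fun q : (α × ℕ × List (Word ℕ)) × List (Rule ℕ ℕ) => rawLetters q.1.2.1 :=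
    primrec_rawLetters.comp (fst.comp (snd.comp fst))
  have hl : Primrec fun q : (α × ℕ × List (Word ℕ)) × List (Rule ℕ ℕ) => labelled q.1.2.2 :=
    primrec_labelled.comp (snd.comp (snd.comp fst))
  have hE : Partrec fun q : (α × ℕ × List (Word ℕ)) × List (Rule ℕ ℕ) =>
      irreduciblePart (rawLetters q.1.2.1) q.2 :=
    partrec_irreduciblePart.comp hL.to_comp .snd
  have hq : Computable fun q : ((α × ℕ × List (Word ℕ)) × List (Rule ℕ ℕ)) × List (Word ℕ) =>
      ((rawLetters q.1.1.2.1, q.1.2, q.2), labelled q.1.1.2.2) :=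
    (pair (pair (hL.comp fst) (pair (snd.comp fst) snd)) (hl.comp fst)).to_comp
  have hS := partrec_sepPart.comp hq
  have hS' : Partrec₂ fun (q : (α × ℕ × List (Word ℕ)) × List (Rule ℕ ℕ)) (E : List (Word ℕ)) =>
      (sepPart (rawLetters q.1.2.1) q.2 E (labelled q.1.2.2)).map fun S => (E, S) :=
    partrec₂_mk (hS.map (pair (snd.comp fst) snd).to₂.to_comp)
  have h := hE.bind hS'
  exact (partrec_systemAlg hgt).bind (partrec₂_mk h)

end Algorithms

end IdRel

theorem theorem5p4p6 :
    -- the procedure `KB2` returns a complete extra information rewriting system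
    (∀ (n m : ℕ) (w : Fin m → IdRel.Word (Fin n))
      (gt : IdRel.Word (Fin n) → IdRel.Word (Fin n) → Prop),
      IdRel.IsAdmissibleWellOrder gt → IdRel.Completable w gt →
      ∃ R2, R2 ∈ IdRel.KB2 w gt ∧ IdRel.IsCompleteEIRS w R2 ∧
        ∀ l c r, (l, c, r) ∈ R2 → gt l r) ∧
    -- a complete extra information rewriting system determines the contracting homotopy
    (∀ (n m : ℕ) (w : Fin m → IdRel.Word (Fin n)) (R2 : List (IdRel.Rule (Fin n) (Fin m))),
      IdRel.IsCompleteEIRS w R2 →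
      (∃! N, IdRel.IsNormalForm w (IdRel.R1 R2) N) ∧
      ∀ N, ∀ hN : IdRel.IsNormalForm w (IdRel.R1 R2) N,
        ∃ h1 : IdRel.GroupoidHom (IdRel.relators w),
          IdRel.IsDeterminedBy w R2 N h1 ∧
          (∀ h1', IdRel.IsDeterminedBy w R2 N h1' → h1' = h1) ∧
          IdRel.IsContractingHomotopy (IdRel.relators w) (IdRel.h0 w N hN.val_eq) h1 ∧
          IdRel.GeneratesPi2 (IdRel.relators w) {c | ∃ g ρ, c = IdRel.sep w N h1 g ρ}) ∧
    -- algorithms, uniform in the presentation and in the ordering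
    (∀ (α : Type) [Primcodable α] (gt : α → IdRel.Word ℕ → IdRel.Word ℕ → Prop),
      ComputablePred (fun q : α × IdRel.Word ℕ × IdRel.Word ℕ => gt q.1 q.2.1 q.2.2) →
      ∃ (A2 : α × ℕ × List (IdRel.Word ℕ) →. List (IdRel.Rule ℕ ℕ))
        (A0 : (α × ℕ × List (IdRel.Word ℕ)) × IdRel.Word ℕ →. IdRel.Word ℕ)
        (A1 : (α × ℕ × List (IdRel.Word ℕ)) × IdRel.Word ℕ × ℕ →. IdRel.YSeq ℕ ℕ)
        (A3 : α × ℕ × List (IdRel.Word ℕ) →. List (IdRel.Word ℕ) × List (IdRel.YSeq ℕ ℕ)),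
        Partrec A2 ∧ Partrec A0 ∧ Partrec A1 ∧ Partrec A3 ∧
        ∀ (a : α) (n m : ℕ) (w : Fin m → IdRel.Word (Fin n)),
          IdRel.IsAdmissibleWellOrder
            (fun u v : IdRel.Word (Fin n) => gt a (IdRel.rawWord u) (IdRel.rawWord v)) →
          IdRel.Completable w (fun u v => gt a (IdRel.rawWord u) (IdRel.rawWord v)) →
          ∃ R2 N h1,
            R2 ∈ IdRel.KB2 w (fun u v => gt a (IdRel.rawWord u) (IdRel.rawWord v)) ∧
            IdRel.IsNormalForm w (IdRel.R1 R2) N ∧ IdRel.IsDeterminedBy w R2 N h1 ∧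
            -- the system itself
            A2 (a, IdRel.rawPres w) = Part.some (R2.map IdRel.rawRule) ∧
            -- `h₀`, that is, the normal form function
            (∀ z, A0 ((a, IdRel.rawPres w), IdRel.rawWord z) =
              Part.some (IdRel.rawWord (N (IdRel.val w z)))) ∧
            -- `h₁` on the edge `[g, x]`, where `g` is given by any word `z`
            (∀ z (x : Fin n), A1 ((a, IdRel.rawPres w), IdRel.rawWord z, (x : ℕ)) =
              Part.some (IdRel.rawYSeq (IdRel.edgeInfo w R2 N (IdRel.val w z) x))) ∧
            -- the elements of a finite `G`, and generators of the module of identities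
            (Finite (IdRel.Grp (IdRel.relators w)) →
              ∃ (E : List (IdRel.Word (Fin n))) (S : List (IdRel.YSeq (Fin n) (Fin m))),
                A3 (a, IdRel.rawPres w) =
                  Part.some (E.map IdRel.rawWord, S.map IdRel.rawYSeq) ∧
                E.Nodup ∧ (∀ z, z ∈ E ↔ ∃ g, z = N g) ∧
                {c | ∃ s ∈ S, c = IdRel.cls w s} = {c | ∃ g ρ, c = IdRel.sep w N h1 g ρ} ∧
                IdRel.GeneratesPi2 (IdRel.relators w) {c | ∃ s ∈ S, c = IdRel.cls w s})) := by
  refine ⟨fun n m w gt hgt hw => ?_, fun n m w R2 hR => ?_, fun α _ gt hgt => ?_⟩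
  · obtain ⟨k, hk, hnew, -⟩ := IdRel.exists_mem_KB2 hgt hw
    have hor := IdRel.isOrientedSystem_iterateKB2 (w := w) hgt k
    exact ⟨_, Part.eq_some_iff.1 hk, hor.isCompleteEIRS hgt hnew,
      fun l c r h => hor.oriented (l, r) ⟨c, h⟩⟩
  · refine ⟨hR.existsUnique_normalForm, fun N hN => ?_⟩
    obtain ⟨h1, hh, huniq⟩ := IdRel.exists_isDeterminedBy w R2 N
    exact ⟨h1, hh, huniq, hR.isContractingHomotopy hN hh, hR.generatesPi2 hN hh⟩
  · refine ⟨IdRel.systemAlg gt, IdRel.normalFormAlg gt, IdRel.edgeAlg gt, IdRel.identitiesAlg gt,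
      IdRel.partrec_systemAlg hgt, IdRel.partrec_normalFormAlg hgt, IdRel.partrec_edgeAlg hgt,
      IdRel.partrec_identitiesAlg hgt, fun a n m w ha hw => ?_⟩
    obtain ⟨k, hk, hnew, hlt⟩ := IdRel.exists_mem_KB2 ha hw
    have hsys := IdRel.completePart_raw ha hnew hlt
    have hR := (IdRel.isOrientedSystem_iterateKB2 (w := w) ha k).isCompleteEIRS ha hnew
    -- From here on only three facts about the output matter: `KB2` returns it, its encoding is
    -- computed, and it is complete.
    generalize IdRel.iterateKB2 w _ k = R2 at hk hsys hR
    obtain ⟨N, hN, -⟩ := hR.existsUnique_normalForm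
    obtain ⟨h1, hh, -⟩ := IdRel.exists_isDeterminedBy w R2 N
    have hA2 : IdRel.systemAlg gt (a, IdRel.rawPres w) = Part.some (R2.map IdRel.rawRule) := hsys
    refine ⟨R2, N, h1, Part.eq_some_iff.1 hk, hN, hh, hA2, fun z => ?_, fun z x => ?_,
      fun hfin => ?_⟩
    · rw [IdRel.normalFormAlg, hA2, Part.bind_some, IdRel.reducePart_raw hR.complete.1,
        Part.map_some, IdRel.rawState, IdRel.reduceWord2_eq_normalForm hR.complete.1 hR.eirs hN]
    · rw [IdRel.edgeAlg, hA2, Part.bind_some, IdRel.edgePart_raw hR hN]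
    · obtain ⟨E, hE, hnodup, hmem⟩ := IdRel.irreduciblePart_raw hR hN
      obtain ⟨S, hS, hsep⟩ := IdRel.sepPart_raw hR hN hh hmem
      refine ⟨E, S, ?_, hnodup, hmem, hsep, ?_⟩
      · rw [IdRel.identitiesAlg, hA2, Part.bind_some]
        change ((IdRel.irreduciblePart (IdRel.rawLetters n) _).bind fun E =>
          (IdRel.sepPart (IdRel.rawLetters n) _ E _).map fun S => (E, S)) = _
        rw [hE, Part.bind_some, hS, Part.map_some]
      · rw [hsep]
        exact hR.generatesPi2 hN hh
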